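/- Let $d\ge 1$ be an integer, $0<p\le 1$ and $0<\alpha\le 1$. Let $S^d$ be the unit sphere of the Euclidean space $\mathbb{R}^{d+1}$ and let $B^d$ be the closed unit ball of the Euclidean space $\mathbb{R}^d$. For $M\in\{S^d,\mathbb{R}^d,B^d\}$ let $(M,|\cdot|^\alpha)$ denote $M$ with the metric $(x,y)\mapsto|x-y|^\alpha$, where $|\cdot|$ is the Euclidean norm of the ambient space. For a metric space $(M,\rho)$ let $\mathcal{F}_p(M,\rho)$ be the Lipschitz free $p$-space over $M$, that is, the completion of the vector space of finitely supported functions $\mu\colon M\to\mathbb{R}$ with $\sum_{x\in M}\mu(x)=0$ with respect to the $p$-norm $$\|\mu\|=\inf\Big\{\Big(\sum_{k=1}^n |a_k|^p\rho(x_k,y_k)^p\Big)^{1/p} : \mu=\sum_{k=1}^n a_k\,(\delta_{x_k}-\delta_{y_k}),\ n\ge 0,\ a_k\in\mathbb{R},\ x_k,y_k\in M\Big\},$$ where $\delta_x$ is the indicator function of $\{x\}$. Write $X\simeq Y$ if there is a linear bijection from $X$ onto $Y$ that is bounded and has a bounded inverse. Then $$\mathcal{F}_p(S^d,|\cdot|^\alpha)\simeq\mathcal{F}_p(\mathbb{R}^d,|\cdot|^\alpha)\qquad\text{and}\qquad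 \mathcal{F}_p(S^d,|\cdot|^\alpha)\simeq\mathcal{F}_p(B^d,|\cdot|^\alpha).$$ -/

import Mathlib

/-- The finitely supported functions `μ : M → ℝ` of total mass zero, i.e. the linear span of the
differences `δ(x) - δ(y)` of point masses.  Choosing a base point `0 ∈ M` and representing the
evaluation functional at `x` by `δ(x) - δ(0)` identifies this space with the linear span of the
evaluations on functions vanishing at `0`; no base point is needed to define it.
The parameter `p` is recorded in the type since it determines the norm put on it below. -/
def Molecule (_p : ℝ) (M : Type*) : Type _ :=
  LinearMap.ker (Finsupp.linearCombination ℝ (fun _ : M => (1 : ℝ)))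

namespace Molecule

noncomputable instance (p : ℝ) (M : Type*) : AddCommGroup (Molecule p M) :=
  inferInstanceAs (AddCommGroup (LinearMap.ker (Finsupp.linearCombination ℝ (fun _ : M => (1 : ℝ)))))

noncomputable instance (p : ℝ) (M : Type*) : Module ℝ (Molecule p M) :=
  inferInstanceAs (Module ℝ (LinearMap.ker (Finsupp.linearCombination ℝ (fun _ : M => (1 : ℝ)))))

/-- The elementary difference `δ(x) - δ(y)` of two point masses. -/
noncomputable def diff (p : ℝ) {M : Type*} (x y : M) : Molecule p M :=
  ⟨Finsupp.single x 1 - Finsupp.single y 1, by simp⟩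

/-- All the numbers `∑ k, (|a k| * d(x k, y k)) ^ p`, where
`μ = ∑ k, a k • (δ(x k) - δ(y k))` is a finite representation of `μ`. -/
def costs {p : ℝ} {M : Type*} [MetricSpace M] (μ : Molecule p M) : Set ℝ :=
  {r | ∃ (n : ℕ) (a : Fin n → ℝ) (x y : Fin n → M),
    μ = ∑ k, a k • diff p (x k) (y k) ∧ r = ∑ k, (|a k| * dist (x k) (y k)) ^ p}

/-- The `p`-th power of the `p`-norm of the Lipschitz free `p`-space: writing
`b k = a k * d(x k, y k)`, this is the infimum of `∑ k, |b k| ^ p` over all representations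
`μ = ∑ k, b k • (δ(x k) - δ(y k)) / d(x k, y k)`. -/
noncomputable def pnormPow {p : ℝ} {M : Type*} [MetricSpace M] (μ : Molecule p M) : ℝ :=
  sInf (costs μ)

section
variable {p : ℝ} {M : Type*} [MetricSpace M]

theorem costs_nonneg {μ : Molecule p M} {r : ℝ} (hr : r ∈ costs μ) : 0 ≤ r := by
  obtain ⟨n, a, x, y, -, rfl⟩ := hr
  positivity

theorem costs_bddBelow (μ : Molecule p M) : BddBelow (costs μ) :=
  ⟨0, fun _ hr => costs_nonneg hr⟩

theorem costs_nonempty (μ : Molecule p M) : (costs μ).Nonempty := by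
  classical
  by_cases h : Nonempty M
  · obtain ⟨o⟩ := h
    let e := μ.1.support.equivFin
    refine ⟨_, μ.1.support.card, fun k => μ.1 (e.symm k), fun k => (e.symm k : M), fun _ => o,
      ?_, rfl⟩
    apply Subtype.ext
    have h0 : μ.1.sum (fun _ c => c) = 0 := by
      have := μ.2
      simpa [Finsupp.linearCombination_apply] using this
    have h1 : ((∑ k, μ.1 (e.symm k) • diff p (e.symm k : M) o : Molecule p M)).1
        = ∑ k, μ.1 (e.symm k) • (Finsupp.single (e.symm k : M) (1 : ℝ) - Finsupp.single o 1) := by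
      exact map_sum (LinearMap.ker (Finsupp.linearCombination ℝ (fun _ : M => (1 : ℝ)))).subtype _ _
    refine Eq.trans ?_ h1.symm
    rw [e.symm.sum_comp (fun z : μ.1.support =>
      μ.1 z • (Finsupp.single (z : M) (1 : ℝ) - Finsupp.single o 1))]
    rw [Finset.sum_coe_sort μ.1.support
      (fun z => μ.1 z • (Finsupp.single (z : M) (1 : ℝ) - Finsupp.single o 1))]
    simp only [smul_sub, Finset.sum_sub_distrib, ← Finset.sum_smul]
    have h2 : ∑ z ∈ μ.1.support, μ.1 z = 0 := h0
    rw [h2]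
    have h3 := Finsupp.sum_single μ.1
    simpa [Finsupp.sum] using h3.symm
  · refine ⟨_, 0, fun _ => 0, Fin.elim0, Fin.elim0, ?_, rfl⟩
    apply Subtype.ext
    ext z
    exact (h ⟨z⟩).elim

theorem pnormPow_nonneg (μ : Molecule p M) : 0 ≤ pnormPow μ :=
  Real.sInf_nonneg fun _ hr => costs_nonneg hr

theorem pnormPow_zero : pnormPow (0 : Molecule p M) = 0 := by
  refine le_antisymm (csInf_le (costs_bddBelow _) ?_) (pnormPow_nonneg _)
  exact ⟨0, fun _ => 0, Fin.elim0, Fin.elim0, by simp, by simp⟩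

theorem pnormPow_add_le (μ ν : Molecule p M) : pnormPow (μ + ν) ≤ pnormPow μ + pnormPow ν := by
  unfold pnormPow
  rw [← csInf_add (costs_nonempty μ) (costs_bddBelow μ) (costs_nonempty ν) (costs_bddBelow ν)]
  refine csInf_le_csInf (costs_bddBelow _) ((costs_nonempty μ).add (costs_nonempty ν)) ?_
  rintro _ ⟨_, ⟨m, a, x, y, hμ, rfl⟩, _, ⟨n, b, z, w, hν, rfl⟩, rfl⟩
  exact ⟨m + n, Fin.append a b, Fin.append x z, Fin.append y w,
    by simp [Fin.sum_univ_add, hμ, hν], by simp [Fin.sum_univ_add]⟩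

theorem pnormPow_smul_le (c : ℝ) (μ : Molecule p M) :
    pnormPow (c • μ) ≤ |c| ^ p * pnormPow μ := by
  unfold pnormPow
  have hc : 0 ≤ |c| ^ p := by positivity
  rw [← smul_eq_mul, ← Real.sInf_smul_of_nonneg hc]
  refine csInf_le_csInf (costs_bddBelow _) ((costs_nonempty μ).smul_set) ?_
  rintro _ ⟨_, ⟨n, a, x, y, hμ, rfl⟩, rfl⟩
  refine ⟨n, fun k => c * a k, x, y, by simp [hμ, Finset.smul_sum, mul_smul], ?_⟩
  simp only [smul_eq_mul, Finset.mul_sum]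
  refine Finset.sum_congr rfl fun k _ => ?_
  rw [abs_mul, mul_assoc, Real.mul_rpow (abs_nonneg c) (by positivity)]

theorem pnormPow_neg (μ : Molecule p M) : pnormPow (-μ) = pnormPow μ := by
  have h : ∀ ν : Molecule p M, pnormPow (-ν) ≤ pnormPow ν := fun ν => by
    simpa using pnormPow_smul_le (-1) ν
  exact le_antisymm (h μ) (by simpa using h (-μ))

/-- For `0 < p ≤ 1` the function `pnormPow` is subadditive and satisfies
`pnormPow (c • μ) = |c| ^ p * pnormPow μ`; the topology of the `p`-norm is the one of the
translation invariant distance `pnormPow (μ - ν)`. -/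
noncomputable instance : SeminormedAddCommGroup (Molecule p M) :=
  AddGroupSeminorm.toSeminormedAddCommGroup
    { toFun := pnormPow
      map_zero' := pnormPow_zero
      add_le' := pnormPow_add_le
      neg' := pnormPow_neg }

instance : UniformContinuousConstSMul ℝ (Molecule p M) :=
  ⟨fun c => (LipschitzWith.of_dist_le_mul (K := ⟨|c| ^ p, by positivity⟩) fun μ ν => by
    rw [dist_eq_norm, dist_eq_norm, ← smul_sub]
    exact pnormPow_smul_le c (μ - ν)).uniformContinuous⟩

end
end Molecule

/-- The Lipschitz free `p`-space `F_p(M)` over the metric space `M`: the completion of the space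
of molecules.  For every base point `o` the canonical map is `x ↦ δ(x) - δ(o)`.  The norm `‖·‖`
found by instance search is the `p`-th power of the `p`-norm of `F_p(M)`, so it induces the same
topology, and a linear map between such spaces is continuous if and only if it is bounded. -/
abbrev LipFree (p : ℝ) (M : Type*) [MetricSpace M] : Type _ :=
  UniformSpace.Completion (Molecule p M)

/-! Let `W` be the molecules over the snowflaked ball `B^d`, and let `X = FinSum ℕ W`. Since norms
are `p`-th powers of `p`-norms, `X` is a dense part of the `ℓ_p`-sum of copies of the free space
over the ball. The molecules over `S^d`, `ℝ^d` and `B^d` are all isomorphic to `X` by Pełczyński's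
decomposition (`BoundedIso.of_isComplementedIn`). The argument runs on spaces of molecules, where
every map is defined on finite combinations, and `BoundedIso.completion` carries the result over at
the end.

`X` is complemented in each space: the ball contains a sequence of disjoint small balls, separated
in proportion to their radii (`finSum_isComplementedIn_closedBall`), and the ball is a Lipschitz
retract of `ℝ^d` and, as a hemisphere, of `S^d`.

Conversely, each space is complemented in `X`. For the ball, one summand suffices. The space `ℝ^d`
is exhausted by concentric dyadic balls and `S^d` is covered by two stereographic charts. With a
partition of unity `w_k` at scale `s_k`, the point `x` goes to the family `s_k w_k(x) (δ(coord_k x)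
- δ(base_k))`. This is bounded by a product rule (`ChartFamily.norm_component_sub_le`) and bounded
overlap; the parametrizations give a left inverse. All charts are built for the Euclidean metric and
then snowflaked. -/

/-! ### Linear maps that are bounded for the given group norms -/

/-- A linear map between seminormed groups is bounded if it increases the norm by at most a
constant factor.  Homogeneity of the norms is not assumed. -/
def IsBoundedLin {X Y : Type*} [SeminormedAddCommGroup X] [Module ℝ X]
    [SeminormedAddCommGroup Y] [Module ℝ Y] (f : X →ₗ[ℝ] Y) : Prop :=
  ∃ C : ℝ, 0 ≤ C ∧ ∀ x, ‖f x‖ ≤ C * ‖x‖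

/-- Two spaces are isomorphic through mutually inverse bounded linear maps. -/
def BoundedIso (X Y : Type*) [SeminormedAddCommGroup X] [Module ℝ X]
    [SeminormedAddCommGroup Y] [Module ℝ Y] : Prop :=
  ∃ (f : X →ₗ[ℝ] Y) (g : Y →ₗ[ℝ] X), IsBoundedLin f ∧ IsBoundedLin g ∧
    (∀ x, g (f x) = x) ∧ ∀ y, f (g y) = y

/-- `X` is isomorphic to a complemented subspace of `Y`. -/
def IsComplementedIn (X Y : Type*) [SeminormedAddCommGroup X] [Module ℝ X]
    [SeminormedAddCommGroup Y] [Module ℝ Y] : Prop :=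
  ∃ (f : X →ₗ[ℝ] Y) (g : Y →ₗ[ℝ] X), IsBoundedLin f ∧ IsBoundedLin g ∧ ∀ x, g (f x) = x

section
variable {X Y Z W : Type*} [SeminormedAddCommGroup X] [Module ℝ X]
  [SeminormedAddCommGroup Y] [Module ℝ Y] [SeminormedAddCommGroup Z] [Module ℝ Z]
  [SeminormedAddCommGroup W] [Module ℝ W]

theorem IsBoundedLin.id : IsBoundedLin (LinearMap.id : X →ₗ[ℝ] X) :=
  ⟨1, zero_le_one, fun x => by simp⟩

theorem IsBoundedLin.comp {g : Y →ₗ[ℝ] Z} {f : X →ₗ[ℝ] Y} (hg : IsBoundedLin g)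
    (hf : IsBoundedLin f) : IsBoundedLin (g ∘ₗ f) := by
  obtain ⟨C, hC, hg⟩ := hg
  obtain ⟨D, hD, hf⟩ := hf
  refine ⟨C * D, by positivity, fun x => ?_⟩
  calc ‖g (f x)‖ ≤ C * ‖f x‖ := hg _
    _ ≤ C * (D * ‖x‖) := by gcongr; exact hf x
    _ = C * D * ‖x‖ := by ring

theorem IsBoundedLin.sub {f g : X →ₗ[ℝ] Y} (hf : IsBoundedLin f)
    (hg : IsBoundedLin g) : IsBoundedLin (f - g) := by
  obtain ⟨C, hC, hg⟩ := hg
  obtain ⟨D, hD, hf⟩ := hf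
  refine ⟨D + C, by positivity, fun x => ?_⟩
  calc ‖f x - g x‖ ≤ ‖f x‖ + ‖g x‖ := norm_sub_le _ _
    _ ≤ D * ‖x‖ + C * ‖x‖ := add_le_add (hf x) (hg x)
    _ = (D + C) * ‖x‖ := by ring

theorem IsBoundedLin.prod {f : X →ₗ[ℝ] Y} {g : X →ₗ[ℝ] Z} (hf : IsBoundedLin f)
    (hg : IsBoundedLin g) : IsBoundedLin (f.prod g) := by
  obtain ⟨C, hC, hg⟩ := hg
  obtain ⟨D, hD, hf⟩ := hf
  refine ⟨D + C, by positivity, fun x => ?_⟩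
  have h1 := hf x
  have h2 := hg x
  have : 0 ≤ C * ‖x‖ := by positivity
  have : 0 ≤ D * ‖x‖ := by positivity
  rw [add_mul]
  exact max_le (h1.trans (by linarith)) (h2.trans (by linarith))

theorem IsBoundedLin.fst : IsBoundedLin (LinearMap.fst ℝ X Y) :=
  ⟨1, zero_le_one, fun x => by simpa using norm_fst_le x⟩

theorem IsBoundedLin.snd : IsBoundedLin (LinearMap.snd ℝ X Y) :=
  ⟨1, zero_le_one, fun x => by simpa using norm_snd_le x⟩

theorem IsBoundedLin.coprod {f : X →ₗ[ℝ] Z} {g : Y →ₗ[ℝ] Z} (hf : IsBoundedLin f)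
    (hg : IsBoundedLin g) : IsBoundedLin (f.coprod g) := by
  obtain ⟨C, hC, hg⟩ := hg
  obtain ⟨D, hD, hf⟩ := hf
  refine ⟨D + C, by positivity, fun x => ?_⟩
  calc ‖f x.1 + g x.2‖ ≤ ‖f x.1‖ + ‖g x.2‖ := norm_add_le _ _
    _ ≤ D * ‖x.1‖ + C * ‖x.2‖ := add_le_add (hf _) (hg _)
    _ ≤ D * ‖x‖ + C * ‖x‖ := by gcongr <;> simp [norm_fst_le, norm_snd_le]
    _ = (D + C) * ‖x‖ := by ring

theorem BoundedIso.refl : BoundedIso X X :=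
  ⟨LinearMap.id, LinearMap.id, .id, .id, fun _ => rfl, fun _ => rfl⟩

theorem BoundedIso.symm (h : BoundedIso X Y) : BoundedIso Y X :=
  let ⟨f, g, hf, hg, hgf, hfg⟩ := h
  ⟨g, f, hg, hf, hfg, hgf⟩

theorem BoundedIso.trans (h : BoundedIso X Y) (h' : BoundedIso Y Z) : BoundedIso X Z := by
  obtain ⟨f, g, hf, hg, hgf, hfg⟩ := h
  obtain ⟨f', g', hf', hg', hgf', hfg'⟩ := h'
  exact ⟨f' ∘ₗ f, g ∘ₗ g', hf'.comp hf, hg.comp hg', fun x => by simp [hgf, hgf'],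
    fun x => by simp [hfg, hfg']⟩

theorem BoundedIso.prodComm : BoundedIso (X × Y) (Y × X) :=
  ⟨(LinearMap.snd ℝ X Y).prod (LinearMap.fst ℝ X Y), (LinearMap.snd ℝ Y X).prod
    (LinearMap.fst ℝ Y X), IsBoundedLin.snd.prod .fst, IsBoundedLin.snd.prod .fst,
    fun _ => rfl, fun _ => rfl⟩

theorem BoundedIso.prodCongr (h : BoundedIso X Y) (h' : BoundedIso Z W) :
    BoundedIso (X × Z) (Y × W) := by
  obtain ⟨f, g, hf, hg, hgf, hfg⟩ := h
  obtain ⟨f', g', hf', hg', hgf', hfg'⟩ := h'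
  refine ⟨(f ∘ₗ LinearMap.fst ℝ X Z).prod (f' ∘ₗ LinearMap.snd ℝ X Z),
    (g ∘ₗ LinearMap.fst ℝ Y W).prod (g' ∘ₗ LinearMap.snd ℝ Y W),
    (hf.comp .fst).prod (hf'.comp .snd), (hg.comp .fst).prod (hg'.comp .snd), ?_, ?_⟩
  · rintro ⟨x, z⟩
    simp [hgf, hgf']
  · rintro ⟨x, z⟩
    simp [hfg, hfg']

theorem BoundedIso.prodAssoc : BoundedIso ((X × Y) × Z) (X × Y × Z) := by
  refine ⟨(LinearMap.fst ℝ X Y ∘ₗ LinearMap.fst ℝ (X × Y) Z).prod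
      ((LinearMap.snd ℝ X Y ∘ₗ LinearMap.fst ℝ (X × Y) Z).prod (LinearMap.snd ℝ (X × Y) Z)),
    ((LinearMap.fst ℝ X (Y × Z)).prod (LinearMap.fst ℝ Y Z ∘ₗ LinearMap.snd ℝ X (Y × Z))).prod
      (LinearMap.snd ℝ Y Z ∘ₗ LinearMap.snd ℝ X (Y × Z)), ?_, ?_, fun _ => rfl, fun _ => rfl⟩
  · exact (IsBoundedLin.fst.comp .fst).prod ((IsBoundedLin.snd.comp .fst).prod .snd)
  · exact (IsBoundedLin.fst.prod (IsBoundedLin.fst.comp .snd)).prod (IsBoundedLin.snd.comp .snd)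

theorem IsComplementedIn.trans (h : IsComplementedIn X Y) (h' : IsComplementedIn Y Z) :
    IsComplementedIn X Z := by
  obtain ⟨f, g, hf, hg, hgf⟩ := h
  obtain ⟨f', g', hf', hg', hgf'⟩ := h'
  exact ⟨f' ∘ₗ f, g ∘ₗ g', hf'.comp hf, hg.comp hg', fun x => by simp [hgf, hgf']⟩

/-- A complemented subspace is a direct factor. -/
theorem IsComplementedIn.exists_prod (h : IsComplementedIn X Y) :
    ∃ V : Submodule ℝ Y, BoundedIso Y (X × V) := by
  obtain ⟨f, g, hf, hg, hgf⟩ := h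
  have hq : ∀ y : Y, (LinearMap.id - f ∘ₗ g : Y →ₗ[ℝ] Y) y ∈ LinearMap.ker g := fun y => by simp [hgf]
  have hq' : IsBoundedLin ((LinearMap.id - f ∘ₗ g).codRestrict (LinearMap.ker g) hq) :=
    IsBoundedLin.id.sub (hf.comp hg)
  refine ⟨LinearMap.ker g, g.prod ((LinearMap.id - f ∘ₗ g).codRestrict _ hq),
    f.coprod (Submodule.subtype _), hg.prod hq',
    hf.coprod ⟨1, zero_le_one, fun x => by simp⟩, fun y => by simp, ?_⟩
  rintro ⟨x, v, hv⟩
  have hv : g v = 0 := hv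
  refine Prod.ext (by simp [hv, hgf]) (Subtype.ext (by simp [hv, hgf]))

end

/-! ### Sums of copies of a space -/

/-- Finitely supported families in `X`, with the sum of the norms as norm. -/
def FinSum (ι X : Type*) [AddCommGroup X] : Type _ := ι →₀ X

namespace FinSum

noncomputable instance (ι X : Type*) [AddCommGroup X] : AddCommGroup (FinSum ι X) :=
  inferInstanceAs (AddCommGroup (ι →₀ X))

noncomputable instance (ι X : Type*) [AddCommGroup X] [Module ℝ X] : Module ℝ (FinSum ι X) :=
  inferInstanceAs (Module ℝ (ι →₀ X))

section
variable {ι κ X Y : Type*} [SeminormedAddCommGroup X] [SeminormedAddCommGroup Y]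

/-- The sum of the norms of the entries of a finitely supported family. -/
noncomputable def normSum (f : ι →₀ X) : ℝ := f.sum fun _ x => ‖x‖

theorem normSum_eq_sum (f : ι →₀ X) {s : Finset ι} (hs : f.support ⊆ s) :
    normSum f = ∑ i ∈ s, ‖f i‖ :=
  Finsupp.sum_of_support_subset _ hs _ fun _ _ => norm_zero

theorem normSum_add_le (f g : ι →₀ X) : normSum (f + g) ≤ normSum f + normSum g := by
  classical
  rw [normSum_eq_sum (f + g) Finsupp.support_add,
    normSum_eq_sum f (Finset.subset_union_left (s₂ := g.support)),
    normSum_eq_sum g (Finset.subset_union_right (s₁ := f.support)), ← Finset.sum_add_distrib]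
  exact Finset.sum_le_sum fun i _ => norm_add_le _ _

noncomputable instance : SeminormedAddCommGroup (FinSum ι X) :=
  AddGroupSeminorm.toSeminormedAddCommGroup
    { toFun := fun f => normSum (X := X) (ι := ι) f
      map_zero' := Finsupp.sum_zero_index
      add_le' := normSum_add_le
      neg' := fun f => by
        refine (normSum_eq_sum (X := X) (ι := ι) (-f)
          (Finsupp.support_neg (ι := ι) (G := X) f).subset).trans ?_
        exact Finset.sum_congr rfl fun i _ => norm_neg _ }

variable [Module ℝ X] [Module ℝ Y]

/-- The inclusion of a summand. -/
noncomputable def incl (i : ι) : X →ₗ[ℝ] FinSum ι X := Finsupp.lsingle i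

/-- The linear map on a sum of copies of `X` with given restrictions to the summands. -/
noncomputable def lift (f : ι → X →ₗ[ℝ] Y) : FinSum ι X →ₗ[ℝ] Y := Finsupp.lsum ℝ f

theorem norm_incl (i : ι) (x : X) : ‖incl i x‖ = ‖x‖ :=
  Finsupp.sum_single_index norm_zero

@[simp]
theorem lift_incl (f : ι → X →ₗ[ℝ] Y) (i : ι) (x : X) : lift f (incl i x) = f i x :=
  Finsupp.sum_single_index (map_zero _)

theorem norm_lift_le {f : ι → X →ₗ[ℝ] Y} {C : ℝ}
    (hf : ∀ i x, ‖f i x‖ ≤ C * ‖x‖) (x : FinSum ι X) : ‖lift f x‖ ≤ C * ‖x‖ := by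
  have h : ‖x‖ = ∑ i ∈ Finsupp.support (M := X) x, ‖(show ι →₀ X from x) i‖ := rfl
  rw [h, Finset.mul_sum]
  exact norm_sum_le_of_le _ fun i _ => hf i _

/-- Families are finitely supported, so identities between linear maps can be tested on single
summands, without any continuity. -/
theorem left_inv_of_incl {f : FinSum ι X →ₗ[ℝ] Y} {g : Y →ₗ[ℝ] FinSum ι X}
    (h : ∀ i x, g (f (incl i x)) = incl i x) (x : FinSum ι X) : g (f x) = x :=
  LinearMap.congr_fun (f := g ∘ₗ f) (g := LinearMap.id) (Finsupp.lhom_ext (M := X) h) x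

theorem isComplementedIn (i : ι) : IsComplementedIn X (FinSum ι X) := by
  classical
  refine ⟨incl i, lift fun j => if j = i then LinearMap.id else 0,
    ⟨1, zero_le_one, fun x => by simp [norm_incl]⟩,
    ⟨1, zero_le_one, norm_lift_le fun j x => ?_⟩, fun x => by simp⟩
  split_ifs <;> simp

theorem congr (h : BoundedIso X Y) : BoundedIso (FinSum ι X) (FinSum ι Y) := by
  obtain ⟨f, g, ⟨C, hC, hf⟩, ⟨D, hD, hg⟩, hgf, hfg⟩ := h
  exact ⟨lift fun i => incl i ∘ₗ f, lift fun i => incl i ∘ₗ g,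
    ⟨C, hC, norm_lift_le fun i x => by simpa [norm_incl] using hf x⟩,
    ⟨D, hD, norm_lift_le fun i x => by simpa [norm_incl] using hg x⟩,
    left_inv_of_incl fun i x => by simp [hgf], left_inv_of_incl fun i x => by simp [hfg]⟩

theorem prod_iso : BoundedIso (FinSum ι (X × Y)) (FinSum ι X × FinSum ι Y) := by
  let f : FinSum ι (X × Y) →ₗ[ℝ] FinSum ι X × FinSum ι Y :=
    lift fun i => (incl i ∘ₗ LinearMap.fst ℝ X Y).prod (incl i ∘ₗ LinearMap.snd ℝ X Y)
  let g₁ : FinSum ι X →ₗ[ℝ] FinSum ι (X × Y) := lift fun i => incl i ∘ₗ LinearMap.inl ℝ X Y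
  let g₂ : FinSum ι Y →ₗ[ℝ] FinSum ι (X × Y) := lift fun i => incl i ∘ₗ LinearMap.inr ℝ X Y
  have h₁ : ∀ x, f (g₁ x) = (x, 0) := fun x => Prod.ext
    (left_inv_of_incl (f := g₁) (g := LinearMap.fst ℝ _ _ ∘ₗ f) (fun i x => by simp [f, g₁]) x)
    (LinearMap.congr_fun (f := LinearMap.snd ℝ _ _ ∘ₗ f ∘ₗ g₁) (g := 0)
      (Finsupp.lhom_ext (M := X) fun i x => by
        change LinearMap.snd ℝ _ _ (f (g₁ (incl i x))) = 0
        simp [f, g₁]) x)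
  have h₂ : ∀ x, f (g₂ x) = (0, x) := fun x => Prod.ext
    (LinearMap.congr_fun (f := LinearMap.fst ℝ _ _ ∘ₗ f ∘ₗ g₂) (g := 0)
      (Finsupp.lhom_ext (M := Y) fun i x => by
        change LinearMap.fst ℝ _ _ (f (g₂ (incl i x))) = 0
        simp [f, g₂]) x)
    (left_inv_of_incl (f := g₂) (g := LinearMap.snd ℝ _ _ ∘ₗ f) (fun i x => by simp [f, g₂]) x)
  refine ⟨f, g₁.coprod g₂, ⟨1, zero_le_one, norm_lift_le fun i x => ?_⟩,
    IsBoundedLin.coprod ⟨1, zero_le_one, norm_lift_le fun i x => ?_⟩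
      ⟨1, zero_le_one, norm_lift_le fun i x => ?_⟩,
    left_inv_of_incl fun i x => ?_, ?_⟩
  · simp [Prod.norm_def, norm_incl]
  · simp [Prod.norm_def, norm_incl]
  · simp [Prod.norm_def, norm_incl]
  · simp [f, g₁, g₂, ← map_add]
  · rintro ⟨x, y⟩
    simp [h₁, h₂]

/-- Reindexing along `e` is an isometry because iterated sums of norms are sums over pairs. -/
theorem iterate_iso (e : ι × κ ≃ ι) : BoundedIso (FinSum κ (FinSum ι X)) (FinSum ι X) := by
  let f : FinSum κ (FinSum ι X) →ₗ[ℝ] FinSum ι X := lift fun k => lift fun i => incl (e (i, k))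
  let g : FinSum ι X →ₗ[ℝ] FinSum κ (FinSum ι X) :=
    lift fun j => incl (e.symm j).2 ∘ₗ incl (e.symm j).1
  refine ⟨f, g, ⟨1, zero_le_one, norm_lift_le fun k =>
      norm_lift_le fun i x => by simp [norm_incl]⟩,
    ⟨1, zero_le_one, norm_lift_le fun i x => by simp [norm_incl]⟩,
    left_inv_of_incl fun k x => ?_, left_inv_of_incl fun j x => by simp [f, g]⟩
  exact LinearMap.congr_fun (f := g ∘ₗ f ∘ₗ incl k) (g := incl k)
    (Finsupp.lhom_ext (M := X) fun i x => by
      change g (f (incl k (incl i x))) = incl k (incl i x)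
      simp [f, g]) x

/-- A sum of infinitely many copies of `X` absorbs a copy of `X`. -/
theorem prod_absorb : BoundedIso (X × FinSum ℕ X) (FinSum ℕ X) := by
  let f₂ : FinSum ℕ X →ₗ[ℝ] FinSum ℕ X := lift fun k => incl (k + 1)
  let g : FinSum ℕ X →ₗ[ℝ] X × FinSum ℕ X := lift fun k =>
    k.casesOn (LinearMap.inl ℝ X _) fun k => LinearMap.inr ℝ X _ ∘ₗ incl k
  have h₂ : ∀ x, g (f₂ x) = (0, x) := fun x =>
    LinearMap.congr_fun (f := g ∘ₗ f₂) (g := LinearMap.inr ℝ X _)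
      (Finsupp.lhom_ext (M := X) fun i x => by
        change g (f₂ (incl i x)) = (0, incl i x)
        simp [f₂, g]) x
  refine ⟨(incl 0).coprod f₂, g,
    IsBoundedLin.coprod ⟨1, zero_le_one, fun x => by simp [norm_incl]⟩
      ⟨1, zero_le_one, norm_lift_le fun i x => by simp [norm_incl]⟩,
    ⟨1, zero_le_one, norm_lift_le fun i x => ?_⟩, ?_,
    left_inv_of_incl fun i x => ?_⟩
  · cases i <;> simp [Prod.norm_def, norm_incl]
  · rintro ⟨x, y⟩
    simp [h₂]
    simp [g]
  · cases i <;> simp [f₂, g]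

end
end FinSum

/-- Pełczyński's decomposition method. -/
theorem BoundedIso.of_isComplementedIn {W Y : Type*} [SeminormedAddCommGroup W] [Module ℝ W]
    [SeminormedAddCommGroup Y] [Module ℝ Y] (h : IsComplementedIn (FinSum ℕ W) Y)
    (h' : IsComplementedIn Y (FinSum ℕ W)) : BoundedIso Y (FinSum ℕ W) := by
  have hX : BoundedIso (FinSum ℕ (FinSum ℕ W)) (FinSum ℕ W) :=
    FinSum.iterate_iso Nat.pairEquiv
  obtain ⟨V, hV⟩ := h.exists_prod
  obtain ⟨Z, hZ⟩ := h'.exists_prod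
  -- With `X = FinSum ℕ W`: from `Y ≃ X × V` and `X × X ≃ X` it follows that `Y ≃ X × Y`. From `X ≃
  -- Y × Z` and `X ≃ FinSum ℕ X` it follows that `X` contains `FinSum ℕ Y` as a factor, so `Y × X ≃
  -- X`.
  have hXX : BoundedIso (FinSum ℕ W × FinSum ℕ W) (FinSum ℕ W) :=
    (BoundedIso.refl.prodCongr hX.symm).trans (FinSum.prod_absorb.trans hX)
  have h1 : BoundedIso Y (FinSum ℕ W × Y) :=
    hV.trans ((hXX.symm.prodCongr .refl).trans
      (BoundedIso.prodAssoc.trans (BoundedIso.refl.prodCongr hV.symm)))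
  have h2 : BoundedIso (FinSum ℕ W) (FinSum ℕ Y × FinSum ℕ Z) :=
    hX.symm.trans ((FinSum.congr hZ).trans FinSum.prod_iso)
  have h3 : BoundedIso (Y × FinSum ℕ W) (FinSum ℕ W) :=
    (BoundedIso.refl.prodCongr h2).trans (BoundedIso.prodAssoc.symm.trans
      ((FinSum.prod_absorb.prodCongr .refl).trans h2.symm))
  exact h1.trans (BoundedIso.prodComm.trans h3)

/-- Isomorphic spaces have isomorphic completions. -/
theorem BoundedIso.completion {X Y : Type*} [SeminormedAddCommGroup X] [Module ℝ X]
    [SeminormedAddCommGroup Y] [Module ℝ Y] [UniformContinuousConstSMul ℝ X]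
    [UniformContinuousConstSMul ℝ Y] (h : BoundedIso X Y) :
    Nonempty (UniformSpace.Completion X ≃L[ℝ] UniformSpace.Completion Y) := by
  obtain ⟨f, g, ⟨C, -, hf⟩, ⟨D, -, hg⟩, hgf, hfg⟩ := h
  let F : X →L[ℝ] Y := ⟨f, AddMonoidHomClass.continuous_of_bound f C hf⟩
  let G : Y →L[ℝ] X := ⟨g, AddMonoidHomClass.continuous_of_bound g D hg⟩
  refine ⟨ContinuousLinearEquiv.equivOfInverse F.completion G.completion (fun x => ?_)
    fun y => ?_⟩
  · induction x using UniformSpace.Completion.induction_on with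
    | hp => exact isClosed_eq (by fun_prop) continuous_id
    | ih x =>
      rw [ContinuousLinearMap.completion_apply_coe, ContinuousLinearMap.completion_apply_coe]
      exact congrArg _ (hgf x)
  · induction y using UniformSpace.Completion.induction_on with
    | hp => exact isClosed_eq (by fun_prop) continuous_id
    | ih y =>
      rw [ContinuousLinearMap.completion_apply_coe, ContinuousLinearMap.completion_apply_coe]
      exact congrArg _ (hfg y)

/-! ### Linear maps on spaces of molecules -/

namespace Molecule

section
variable {p : ℝ} {M B V : Type*}

/-- The linear map sending `δ(x) - δ(y)` to `f x - f y`. -/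
noncomputable def lift [AddCommGroup V] [Module ℝ V] (f : M → V) : Molecule p M →ₗ[ℝ] V :=
  Finsupp.linearCombination ℝ f ∘ₗ
    (LinearMap.ker (Finsupp.linearCombination ℝ (fun _ : M => (1 : ℝ)))).subtype

@[simp]
theorem lift_diff [AddCommGroup V] [Module ℝ V] (f : M → V) (x y : M) :
    lift f (diff p x y) = f x - f y := by
  change Finsupp.linearCombination ℝ f (Finsupp.single x 1 - Finsupp.single y 1) = _
  simp

@[simp]
theorem diff_sub_diff (x y z : M) : diff p x z - diff p y z = diff p x y :=
  Subtype.ext (sub_sub_sub_cancel_right _ _ _)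

theorem diff_add_diff (x y z : M) : diff p x y + diff p y z = diff p x z :=
  Subtype.ext (sub_add_sub_cancel _ _ _)

variable [MetricSpace M] [MetricSpace B]

theorem apply_eq_of_diff [AddCommGroup V] [Module ℝ V] {f g : Molecule p M →ₗ[ℝ] V}
    (h : ∀ x y, f (diff p x y) = g (diff p x y)) (μ : Molecule p M) : f μ = g μ := by
  obtain ⟨_, n, a, x, y, hμ, -⟩ := costs_nonempty μ
  simp [hμ, h]

theorem norm_smul_diff_le (c : ℝ) (x y : M) : ‖c • diff p x y‖ ≤ (|c| * dist x y) ^ p :=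
  csInf_le (costs_bddBelow _) ⟨1, fun _ => c, fun _ => x, fun _ => y, by simp, by simp⟩

/-- The norm is an infimum over representations, so a bound on multiples of elementary differences
passes to all molecules. The scalar `c` occurs in the hypothesis because the norm of `V` need not be
homogeneous. -/
theorem norm_lift_le [SeminormedAddCommGroup V] [Module ℝ V] {f : M → V} {K : ℝ} (hK : 0 ≤ K)
    (hf : ∀ (c : ℝ) (x y : M), ‖c • (f x - f y)‖ ≤ K * (|c| * dist x y) ^ p)
    (μ : Molecule p M) : ‖lift f μ‖ ≤ K * ‖μ‖ := by
  change _ ≤ K * sInf (costs μ)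
  rw [← smul_eq_mul, ← Real.sInf_smul_of_nonneg hK]
  refine le_csInf (costs_nonempty μ).smul_set ?_
  rintro _ ⟨_, ⟨n, a, x, y, hμ, rfl⟩, rfl⟩
  simp only [hμ, map_sum, map_smul, lift_diff, smul_eq_mul, Finset.mul_sum]
  exact norm_sum_le_of_le _ fun k _ => hf _ _ _

/-- A Lipschitz retract of `M` has a complemented space of molecules. -/
theorem isComplementedIn_of_retract (hp : 0 < p) [Nonempty B] {i : B → M} {r : M → B} {C : ℝ}
    (hC : 0 ≤ C) (hi : ∀ u v, dist (i u) (i v) ≤ C * dist u v)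
    (hr : ∀ x y, dist (r x) (r y) ≤ C * dist x y) (hri : ∀ u, r (i u) = u) :
    IsComplementedIn (Molecule p B) (Molecule p M) := by
  obtain ⟨b⟩ := ‹Nonempty B›
  have hCp : 0 ≤ C ^ p := by positivity
  refine ⟨lift fun u => diff p (i u) (i b), lift fun x => diff p (r x) b,
    ⟨C ^ p, hCp, norm_lift_le hCp fun c u v => ?_⟩,
    ⟨C ^ p, hCp, norm_lift_le hCp fun c x y => ?_⟩, ?_⟩
  · rw [diff_sub_diff, ← Real.mul_rpow hC (by positivity)]
    refine (norm_smul_diff_le _ _ _).trans (Real.rpow_le_rpow (by positivity) ?_ hp.le)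
    nlinarith [hi u v, abs_nonneg c]
  · rw [diff_sub_diff, ← Real.mul_rpow hC (by positivity)]
    refine (norm_smul_diff_le _ _ _).trans (Real.rpow_le_rpow (by positivity) ?_ hp.le)
    nlinarith [hr x y, abs_nonneg c]
  · exact apply_eq_of_diff (f := lift (fun x => diff p (r x) b) ∘ₗ lift fun u => diff p (i u) (i b))
      (g := LinearMap.id) fun u v => by simp [hri]

end
end Molecule

/-! ### Families of charts -/

/-- A sequence of Lipschitz maps from `B` to `M` at prescribed scales, together with Lipschitz
maps back and a sequence of cut-off functions adapted to these scales. -/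
structure ChartFamily (M B : Type*) [MetricSpace M] [MetricSpace B] where
  /-- The parametrizations. -/
  param : ℕ → B → M
  /-- The coordinate maps. -/
  coord : ℕ → M → B
  /-- The cut-off functions. -/
  weight : ℕ → M → ℝ
  /-- The scales of the charts. -/
  scale : ℕ → ℝ
  /-- The base points of the charts. -/
  base : ℕ → B
  /-- A set of indices containing those of the cut-off functions not vanishing at a point. -/
  active : M → Finset ℕ
  /-- The common bound for all constants. -/
  bound : ℝ
  bound_nonneg : 0 ≤ bound
  scale_pos : ∀ k, 0 < scale k
  dist_le : ∀ u v : B, dist u v ≤ bound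
  param_lip : ∀ k u v, dist (param k u) (param k v) ≤ bound * scale k * dist u v
  coord_lip : ∀ k x y, scale k * dist (coord k x) (coord k y) ≤ bound * dist x y
  weight_nonneg : ∀ k x, 0 ≤ weight k x
  weight_le_one : ∀ k x, weight k x ≤ 1
  weight_lip : ∀ k x y, scale k * |weight k x - weight k y| ≤ bound * dist x y
  card_active : ∀ x, (active x).card ≤ 2
  weight_eq_zero : ∀ x, ∀ k ∉ active x, weight k x = 0

namespace ChartFamily

section
variable {M B : Type*} [MetricSpace M] [MetricSpace B] (F : ChartFamily M B) (p : ℝ)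

/-- The component of the image of a point of `M` in the space over the `k`-th chart. -/
noncomputable def component (k : ℕ) (x : M) : Molecule p B :=
  (F.scale k * F.weight k x) • Molecule.diff p (F.coord k x) (F.base k)

theorem component_eq_zero {k : ℕ} {x : M} (h : F.weight k x = 0) : F.component p k x = 0 := by
  simp [component, h]

/-- The image of a point of `M` in the sum of the spaces over the charts. -/
noncomputable def split (x : M) : FinSum ℕ (Molecule p B) :=
  ∑ k ∈ F.active x, FinSum.incl k (F.component p k x)

/-- Frees the sum from the point-dependent set `active x`, so that two points can be compared over a
common index set. -/
theorem split_eq_sum {x : M} {s : Finset ℕ} (hs : ∀ k ∉ s, F.weight k x = 0) :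
    F.split p x = ∑ k ∈ s, FinSum.incl k (F.component p k x) := by
  classical
  trans ∑ k ∈ F.active x ∪ s, FinSum.incl k (F.component p k x)
  · refine Finset.sum_subset Finset.subset_union_left fun k _ hk => ?_
    rw [F.component_eq_zero p (F.weight_eq_zero x k hk), map_zero]
  · refine (Finset.sum_subset Finset.subset_union_right fun k _ hk => ?_).symm
    rw [F.component_eq_zero p (hs k hk), map_zero]

variable {p}

/-- A product rule: one term moves the coordinate with the weight fixed, the other changes the
weight and pays at most the diameter of `B`. The factor `scale k` offsets the Lipschitz constants of
order `1 / scale k` of coordinate and weight. -/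
theorem norm_component_sub_le (hp : 0 < p) (k : ℕ) (c : ℝ) (x y : M) :
    ‖c • (F.component p k x - F.component p k y)‖ ≤
      (F.bound ^ p + (F.bound * F.bound) ^ p) * (|c| * dist x y) ^ p := by
  have hC := F.bound_nonneg
  have hs := (F.scale_pos k).le
  have hw := F.weight_nonneg k x
  have hw1 := F.weight_le_one k x
  have h : c • (F.component p k x - F.component p k y) =
      (c * (F.scale k * F.weight k x)) • Molecule.diff p (F.coord k x) (F.coord k y) +
      (c * (F.scale k * (F.weight k x - F.weight k y))) •
        Molecule.diff p (F.coord k y) (F.base k) := by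
    rw [component, component, ← Molecule.diff_add_diff (F.coord k x) (F.coord k y) (F.base k)]
    module
  rw [h, add_mul, ← Real.mul_rpow hC (by positivity), ← Real.mul_rpow (by positivity)
    (by positivity)]
  refine (norm_add_le _ _).trans (add_le_add ?_ ?_)
  · refine (Molecule.norm_smul_diff_le _ _ _).trans (Real.rpow_le_rpow (by positivity) ?_ hp.le)
    rw [abs_mul, abs_of_nonneg (mul_nonneg hs hw)]
    calc |c| * (F.scale k * F.weight k x) * dist (F.coord k x) (F.coord k y)
        = |c| * (F.weight k x * (F.scale k * dist (F.coord k x) (F.coord k y))) := by ring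
      _ ≤ |c| * (1 * (F.bound * dist x y)) := by
          refine mul_le_mul_of_nonneg_left ?_ (abs_nonneg c)
          exact mul_le_mul hw1 (F.coord_lip k x y) (by positivity) zero_le_one
      _ = F.bound * (|c| * dist x y) := by ring
  · refine (Molecule.norm_smul_diff_le _ _ _).trans (Real.rpow_le_rpow (by positivity) ?_ hp.le)
    rw [abs_mul, abs_mul, abs_of_nonneg hs]
    calc |c| * (F.scale k * |F.weight k x - F.weight k y|) * dist (F.coord k y) (F.base k)
      _ ≤ |c| * (F.bound * dist x y) * F.bound := by
          have := F.weight_lip k x y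
          exact mul_le_mul (by gcongr) (F.dist_le _ _) dist_nonneg (by positivity)
      _ = F.bound * F.bound * (|c| * dist x y) := by ring

theorem isBoundedLin_lift_split (hp : 0 < p) :
    IsBoundedLin (Molecule.lift (p := p) (F.split p)) := by
  classical
  have hC := F.bound_nonneg
  refine ⟨4 * (F.bound ^ p + (F.bound * F.bound) ^ p), by positivity,
    Molecule.norm_lift_le (by positivity) fun c x y => ?_⟩
  rw [F.split_eq_sum p (s := F.active x ∪ F.active y) fun k hk => F.weight_eq_zero x k
      fun h => hk (Finset.mem_union_left _ h),
    F.split_eq_sum p (s := F.active x ∪ F.active y) fun k hk => F.weight_eq_zero y k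
      fun h => hk (Finset.mem_union_right _ h), ← Finset.sum_sub_distrib, Finset.smul_sum]
  refine (norm_sum_le_of_le (n := fun _ => (F.bound ^ p + (F.bound * F.bound) ^ p) *
    (|c| * dist x y) ^ p) _ fun k _ => ?_).trans ((Finset.sum_const _).le.trans ?_)
  · rw [← map_sub, ← map_smul, FinSum.norm_incl]
    exact F.norm_component_sub_le hp k c x y
  -- At most two charts are active at each of the two points.
  · have h : ((F.active x ∪ F.active y).card : ℝ) ≤ 4 := by
      have h1 := Finset.card_union_le (F.active x) (F.active y)
      have h2 := F.card_active x
      have h3 := F.card_active y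
      exact_mod_cast (by omega : (F.active x ∪ F.active y).card ≤ 4)
    rw [nsmul_eq_mul, mul_assoc]
    gcongr

variable (p) in
/-- The map induced by the parametrizations on the sum of the spaces over the charts. -/
noncomputable def glue : FinSum ℕ (Molecule p B) →ₗ[ℝ] Molecule p M :=
  FinSum.lift fun k => Molecule.lift fun u =>
    (F.scale k)⁻¹ • Molecule.diff p (F.param k u) (F.param k (F.base k))

theorem glue_incl_diff (k : ℕ) (u v : B) : F.glue p (FinSum.incl k (Molecule.diff p u v)) =
    (F.scale k)⁻¹ • Molecule.diff p (F.param k u) (F.param k v) := by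
  rw [glue, FinSum.lift_incl, Molecule.lift_diff, ← smul_sub, Molecule.diff_sub_diff]

theorem isBoundedLin_glue (hp : 0 < p) : IsBoundedLin (F.glue p) := by
  have hC := F.bound_nonneg
  refine ⟨F.bound ^ p, by positivity, FinSum.norm_lift_le fun k =>
    Molecule.norm_lift_le (by positivity) fun c u v => ?_⟩
  have hs := F.scale_pos k
  rw [← smul_sub, Molecule.diff_sub_diff, smul_smul, ← Real.mul_rpow hC (by positivity)]
  refine (Molecule.norm_smul_diff_le _ _ _).trans (Real.rpow_le_rpow (by positivity) ?_ hp.le)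
  rw [abs_mul, abs_of_pos (inv_pos.2 hs)]
  calc |c| * (F.scale k)⁻¹ * dist (F.param k u) (F.param k v)
      ≤ |c| * (F.scale k)⁻¹ * (F.bound * F.scale k * dist u v) := by
        gcongr
        exact F.param_lip k u v
    _ = F.bound * (|c| * dist u v) := by field_simp

/-- If the charts cover `M` and the cut-off functions form a partition of unity, then the
molecules of `M` form a complemented subspace. -/
theorem isComplementedIn_finSum (hp : 0 < p) (o : M) (hbase : ∀ k, F.param k (F.base k) = o)
    (hcover : ∀ k x, F.weight k x ≠ 0 → F.param k (F.coord k x) = x)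
    (hsum : ∀ x, ∃ s : Finset ℕ, (∀ k ∉ s, F.weight k x = 0) ∧ ∑ k ∈ s, F.weight k x = 1) :
    IsComplementedIn (Molecule p M) (FinSum ℕ (Molecule p B)) := by
  refine ⟨Molecule.lift (F.split p), F.glue p, F.isBoundedLin_lift_split hp,
    F.isBoundedLin_glue hp, ?_⟩
  -- All base points are sent to the same `o`, so each chart contributes a multiple of the same
  -- molecule and the weights add up to one.
  have h : ∀ x, F.glue p (F.split p x) = Molecule.diff p x o := fun x => by
    obtain ⟨s, hs, h1⟩ := hsum x
    rw [F.split_eq_sum p hs, map_sum]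
    trans ∑ k ∈ s, F.weight k x • Molecule.diff p x o
    · refine Finset.sum_congr rfl fun k _ => ?_
      rw [component, map_smul, map_smul, glue_incl_diff, hbase, smul_smul]
      by_cases hk : F.weight k x = 0
      · simp [hk]
      · rw [hcover k x hk]
        have := (F.scale_pos k).ne'
        congr 1
        field_simp
    · rw [← Finset.sum_smul, h1, one_smul]
  exact fun μ => Molecule.apply_eq_of_diff (f := F.glue p ∘ₗ Molecule.lift (F.split p))
    (g := LinearMap.id) (fun x y => by simp [h]) μ

/-- If the charts are disjoint and the cut-off functions separate them, then the sum of the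
spaces over the charts is complemented. -/
theorem finSum_isComplementedIn (hp : 0 < p) (hcoord : ∀ k u, F.coord k (F.param k u) = u)
    (hone : ∀ k u, F.weight k (F.param k u) = 1)
    (hzero : ∀ k j u, j ≠ k → F.weight j (F.param k u) = 0) :
    IsComplementedIn (FinSum ℕ (Molecule p B)) (Molecule p M) := by
  refine ⟨F.glue p, Molecule.lift (F.split p), F.isBoundedLin_glue hp,
    F.isBoundedLin_lift_split hp, FinSum.left_inv_of_incl fun k μ => ?_⟩
  refine Molecule.apply_eq_of_diff (f := Molecule.lift (F.split p) ∘ₗ F.glue p ∘ₗ FinSum.incl k)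
    (g := FinSum.incl k) (fun u v => ?_) μ
  -- On the image of the `k`-th chart only the `k`-th weight survives, and it equals one.
  have h : ∀ u, F.split p (F.param k u) =
      FinSum.incl k (F.scale k • Molecule.diff p u (F.base k)) := fun u => by
    rw [F.split_eq_sum p (s := {k}) fun j hj => hzero k j u (by simpa using hj)]
    simp [component, hone, hcoord]
  have := (F.scale_pos k).ne'
  simp only [LinearMap.comp_apply, glue_incl_diff, map_smul, Molecule.lift_diff, h]
  rw [← smul_sub, ← map_sub, Molecule.diff_sub_diff, smul_smul, inv_mul_cancel₀ this, one_smul]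

end

/-! ### Snowflakes of chart families -/

section
open Metric
variable {M B : Type*} [MetricSpace M] [MetricSpace B] (F : ChartFamily M B)
  {α : ℝ} (hα₀ : 0 < α) (hα₁ : α ≤ 1)

/-- A family of charts of `M` induces one of the snowflake of `M`. -/
noncomputable def snowflaking :
    ChartFamily (Snowflaking M α hα₀ hα₁) (Snowflaking B α hα₀ hα₁) where
  param k u := .toSnowflaking (F.param k u.ofSnowflaking)
  coord k x := .toSnowflaking (F.coord k x.ofSnowflaking)
  weight k x := F.weight k x.ofSnowflaking
  scale k := F.scale k ^ α
  base k := .toSnowflaking (F.base k)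
  active x := F.active x.ofSnowflaking
  bound := F.bound ^ α
  bound_nonneg := Real.rpow_nonneg F.bound_nonneg _
  scale_pos k := Real.rpow_pos_of_pos (F.scale_pos k) _
  dist_le := by
    rintro ⟨u⟩ ⟨v⟩
    exact Real.rpow_le_rpow dist_nonneg (F.dist_le u v) hα₀.le
  param_lip := by
    rintro k ⟨u⟩ ⟨v⟩
    have hC := F.bound_nonneg
    have hs := (F.scale_pos k).le
    change dist (F.param k u) (F.param k v) ^ α ≤ F.bound ^ α * F.scale k ^ α * dist u v ^ α
    rw [← Real.mul_rpow hC hs, ← Real.mul_rpow (by positivity) dist_nonneg]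
    exact Real.rpow_le_rpow dist_nonneg (F.param_lip k u v) hα₀.le
  coord_lip := by
    rintro k ⟨x⟩ ⟨y⟩
    have hs := (F.scale_pos k).le
    change F.scale k ^ α * dist (F.coord k x) (F.coord k y) ^ α ≤ F.bound ^ α * dist x y ^ α
    rw [← Real.mul_rpow hs dist_nonneg, ← Real.mul_rpow F.bound_nonneg dist_nonneg]
    exact Real.rpow_le_rpow (by positivity) (F.coord_lip k x y) hα₀.le
  weight_nonneg k x := F.weight_nonneg k _
  weight_le_one k x := F.weight_le_one k _
  weight_lip := by
    rintro k ⟨x⟩ ⟨y⟩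
    have hs := (F.scale_pos k).le
    change F.scale k ^ α * |F.weight k x - F.weight k y| ≤ F.bound ^ α * dist x y ^ α
    -- Weights differ by at most `1`, and `t ≤ t ^ α` on `[0, 1]`; this turns a Lipschitz weight
    -- into one that is Lipschitz for the snowflake.
    have h1 : |F.weight k x - F.weight k y| ≤ 1 := by
      have := F.weight_nonneg k x
      have := F.weight_nonneg k y
      have := F.weight_le_one k x
      have := F.weight_le_one k y
      exact abs_le.2 ⟨by linarith, by linarith⟩
    calc F.scale k ^ α * |F.weight k x - F.weight k y|
        ≤ F.scale k ^ α * |F.weight k x - F.weight k y| ^ α := by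
          gcongr
          exact Real.self_le_rpow_of_le_one (abs_nonneg _) h1 hα₁
      _ = (F.scale k * |F.weight k x - F.weight k y|) ^ α :=
          (Real.mul_rpow hs (abs_nonneg _)).symm
      _ ≤ (F.bound * dist x y) ^ α :=
          Real.rpow_le_rpow (by positivity) (F.weight_lip k x y) hα₀.le
      _ = F.bound ^ α * dist x y ^ α := Real.mul_rpow F.bound_nonneg dist_nonneg
  card_active x := F.card_active _
  weight_eq_zero x := F.weight_eq_zero _

end
end ChartFamily

/-- Snowflakes of Lipschitz retracts have complemented spaces of molecules. -/
theorem Molecule.isComplementedIn_snowflaking_of_retract {M B : Type*} [MetricSpace M]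
    [MetricSpace B] {p : ℝ} (hp : 0 < p) {α : ℝ} (hα₀ : 0 < α) (hα₁ : α ≤ 1) [Nonempty B]
    {i : B → M} {r : M → B} {C : ℝ}
    (hC : 0 ≤ C) (hi : ∀ u v, dist (i u) (i v) ≤ C * dist u v)
    (hr : ∀ x y, dist (r x) (r y) ≤ C * dist x y) (hri : ∀ u, r (i u) = u) :
    IsComplementedIn (Molecule p (Metric.Snowflaking B α hα₀ hα₁))
      (Molecule p (Metric.Snowflaking M α hα₀ hα₁)) := by
  have : Nonempty (Metric.Snowflaking B α hα₀ hα₁) := .map Metric.Snowflaking.toSnowflaking ‹_›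
  refine isComplementedIn_of_retract hp (i := fun u => .toSnowflaking (i u.ofSnowflaking))
    (r := fun x => .toSnowflaking (r x.ofSnowflaking)) (C := C ^ α) (by positivity) ?_ ?_ ?_
  · rintro ⟨u⟩ ⟨v⟩
    change dist (i u) (i v) ^ α ≤ C ^ α * dist u v ^ α
    rw [← Real.mul_rpow hC dist_nonneg]
    exact Real.rpow_le_rpow dist_nonneg (hi u v) hα₀.le
  · rintro ⟨x⟩ ⟨y⟩
    change dist (r x) (r y) ^ α ≤ C ^ α * dist x y ^ α
    rw [← Real.mul_rpow hC dist_nonneg]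
    exact Real.rpow_le_rpow dist_nonneg (hr x y) hα₀.le
  · rintro ⟨u⟩
    simp [hri]

/-! ### Truncation and radial retraction -/

/-- Truncation of a real number to the unit interval. -/
noncomputable def unitClamp (t : ℝ) : ℝ := max 0 (min 1 t)

theorem unitClamp_nonneg (t : ℝ) : 0 ≤ unitClamp t := le_max_left _ _

theorem unitClamp_le_one (t : ℝ) : unitClamp t ≤ 1 := max_le zero_le_one (min_le_left _ _)

theorem unitClamp_of_one_le {t : ℝ} (h : 1 ≤ t) : unitClamp t = 1 := by
  simp [unitClamp, min_eq_left h]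

theorem unitClamp_of_nonpos {t : ℝ} (h : t ≤ 0) : unitClamp t = 0 := by
  simp [unitClamp, h]

theorem unitClamp_mono {s t : ℝ} (h : s ≤ t) : unitClamp s ≤ unitClamp t :=
  max_le_max le_rfl (min_le_min le_rfl h)

theorem abs_unitClamp_sub_le (s t : ℝ) : |unitClamp s - unitClamp t| ≤ |s - t| := by
  unfold unitClamp
  rw [max_comm 0, max_comm 0]
  refine (abs_max_sub_max_le_abs _ _ _).trans ?_
  simpa using abs_min_sub_min_le_max 1 s 1 t

/-- This symmetry makes the weights at opposite poles of the sphere add up to one. -/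
theorem unitClamp_one_sub (t : ℝ) : unitClamp (1 - t) = 1 - unitClamp t := by
  rcases le_total t 0 with h | h
  · rw [unitClamp_of_nonpos h, unitClamp_of_one_le (by linarith), sub_zero]
  rcases le_total t 1 with h' | h'
  · simp [unitClamp, h, h']
  · rw [unitClamp_of_one_le h', unitClamp_of_nonpos (by linarith), sub_self]

section
variable {E : Type*} [NormedAddCommGroup E] [NormedSpace ℝ E]

/-- The radial retraction onto the closed unit ball. -/
noncomputable def radialRetraction (x : E) : Metric.closedBall (0 : E) 1 :=
  ⟨(max 1 ‖x‖)⁻¹ • x, by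
    have h : 0 < max 1 ‖x‖ := lt_max_of_lt_left one_pos
    rw [mem_closedBall_zero_iff, norm_smul, norm_inv, Real.norm_of_nonneg h.le,
      inv_mul_le_iff₀ h, mul_one]
    exact le_max_right _ _⟩

theorem radialRetraction_of_norm_le {x : E} (h : ‖x‖ ≤ 1) : (radialRetraction x : E) = x := by
  simp [radialRetraction, h]

theorem radialRetraction_coe (u : Metric.closedBall (0 : E) 1) :
    radialRetraction (u : E) = u :=
  Subtype.ext (radialRetraction_of_norm_le (mem_closedBall_zero_iff.1 u.2))

theorem dist_radialRetraction_le (x y : E) :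
    dist (radialRetraction x) (radialRetraction y) ≤ 2 * ‖x - y‖ := by
  have hx : 0 < max 1 ‖x‖ := lt_max_of_lt_left one_pos
  have hy : 0 < max 1 ‖y‖ := lt_max_of_lt_left one_pos
  have hx1 : (max 1 ‖x‖)⁻¹ ≤ 1 := inv_le_one_of_one_le₀ (le_max_left _ _)
  rw [Subtype.dist_eq, dist_eq_norm]
  change ‖(max 1 ‖x‖)⁻¹ • x - (max 1 ‖y‖)⁻¹ • y‖ ≤ _
  -- Separates the change of vector from the change of radial factor; each contributes `‖x - y‖`,
  -- whence the constant `2` in any normed space.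
  have h : (max 1 ‖x‖)⁻¹ • x - (max 1 ‖y‖)⁻¹ • y =
      (max 1 ‖x‖)⁻¹ • (x - y) + ((max 1 ‖x‖)⁻¹ * (max 1 ‖y‖ - max 1 ‖x‖)) •
        ((max 1 ‖y‖)⁻¹ • y) := by
    match_scalars <;> field_simp
    ring
  have h1 : ‖(max 1 ‖y‖)⁻¹ • y‖ ≤ 1 := mem_closedBall_zero_iff.1 (radialRetraction y).2
  have h2 : |max 1 ‖y‖ - max 1 ‖x‖| ≤ ‖x - y‖ := by
    rw [max_comm 1, max_comm 1, norm_sub_rev]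
    exact (abs_max_sub_max_le_abs _ _ _).trans (abs_norm_sub_norm_le _ _)
  rw [h, two_mul]
  refine (norm_add_le _ _).trans (add_le_add ?_ ?_)
  · rw [norm_smul, norm_inv, Real.norm_of_nonneg hx.le]
    exact mul_le_of_le_one_left (norm_nonneg _) hx1
  · rw [norm_smul, norm_mul, norm_inv, Real.norm_of_nonneg hx.le, Real.norm_eq_abs]
    calc (max 1 ‖x‖)⁻¹ * |max 1 ‖y‖ - max 1 ‖x‖| * ‖(max 1 ‖y‖)⁻¹ • y‖
        ≤ 1 * ‖x - y‖ * 1 := by gcongr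
      _ = ‖x - y‖ := by ring

theorem dist_closedBall_le {G : Type*} [SeminormedAddCommGroup G]
    (u v : Metric.closedBall (0 : G) 1) : dist u v ≤ 2 := by
  have hu := mem_closedBall_zero_iff.1 u.2
  have hv := mem_closedBall_zero_iff.1 v.2
  rw [Subtype.dist_eq, dist_eq_norm]
  exact (norm_sub_le _ _).trans (by linarith)

/-! ### Disjoint small balls in the unit ball -/

/-- Cut-off functions for disjoint balls accumulating at the origin along the vector `e`. -/
noncomputable def bump (e : E) (k : ℕ) (x : E) : ℝ :=
  -- Equal to `1` up to distance `2^{-k} / 16` from the centre and to `0` from twice that distance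
  -- on.
  unitClamp (2 - ‖x - ((1 / 2 : ℝ) ^ k / 2) • e‖ / ((1 / 2 : ℝ) ^ k / 16))

theorem norm_lt_of_bump_ne_zero {e : E} {k : ℕ} {x : E} (h : bump e k x ≠ 0) :
    ‖x - ((1 / 2 : ℝ) ^ k / 2) • e‖ < (1 / 2 : ℝ) ^ k / 8 := by
  by_contra! hx
  refine h (unitClamp_of_nonpos ?_)
  have : (2 : ℝ) ≤ ‖x - ((1 / 2 : ℝ) ^ k / 2) • e‖ / ((1 / 2 : ℝ) ^ k / 16) := by
    rw [le_div_iff₀ (by positivity)]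
    linarith
  linarith

/-- For `j < k` the centres are at least `2^{-j} / 4` apart, while the support radii add up to at
most `3 · 2^{-j} / 16`. -/
theorem bump_disjoint_of_lt {e : E} (he : ‖e‖ = 1) {j k : ℕ} (hjk : j < k) {x : E}
    (hj : bump e j x ≠ 0) (hk : bump e k x ≠ 0) : False := by
  have h1 := norm_lt_of_bump_ne_zero hj
  have h2 := norm_lt_of_bump_ne_zero hk
  have h3 : (1 / 2 : ℝ) ^ k ≤ (1 / 2 : ℝ) ^ j / 2 := by
    have := pow_le_pow_of_le_one (by norm_num : (0 : ℝ) ≤ 1 / 2) (by norm_num) hjk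
    rw [pow_succ] at this
    linarith
  have h4 : ((1 / 2 : ℝ) ^ j / 2 - (1 / 2 : ℝ) ^ k / 2) ≤
      ‖x - ((1 / 2 : ℝ) ^ k / 2) • e‖ + ‖x - ((1 / 2 : ℝ) ^ j / 2) • e‖ := by
    refine le_trans ?_ (norm_sub_le _ _)
    rw [sub_sub_sub_cancel_left, ← sub_smul, norm_smul, he, mul_one]
    exact le_abs_self _
  have h5 : 0 < (1 / 2 : ℝ) ^ j := by positivity
  linarith

theorem bump_disjoint {e : E} (he : ‖e‖ = 1) {j k : ℕ} {x : E}
    (hj : bump e j x ≠ 0) (hk : bump e k x ≠ 0) : j = k := by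
  rcases lt_trichotomy j k with h | h | h
  · exact (bump_disjoint_of_lt he h hj hk).elim
  · exact h
  · exact (bump_disjoint_of_lt he h hk hj).elim

open Classical in
/-- Disjoint balls in the unit ball. -/
noncomputable def ballCharts {e : E} (he : ‖e‖ = 1) :
    ChartFamily (Metric.closedBall (0 : E) 1) (Metric.closedBall (0 : E) 1) where
  param k u := ⟨((1 / 2 : ℝ) ^ k / 2) • e + ((1 / 2 : ℝ) ^ k / 16) • (u : E), by
    have h : (1 / 2 : ℝ) ^ k ≤ 1 := pow_le_one₀ (by norm_num) (by norm_num)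
    have h0 : 0 < (1 / 2 : ℝ) ^ k := by positivity
    have hu := mem_closedBall_zero_iff.1 u.2
    rw [mem_closedBall_zero_iff]
    refine (norm_add_le _ _).trans ?_
    rw [norm_smul, norm_smul, he, Real.norm_of_nonneg (by positivity),
      Real.norm_of_nonneg (by positivity)]
    nlinarith⟩
  coord k x := radialRetraction
    (((1 / 2 : ℝ) ^ k / 16)⁻¹ • ((x : E) - ((1 / 2 : ℝ) ^ k / 2) • e))
  weight k x := bump e k x
  scale k := (1 / 2 : ℝ) ^ k / 16
  base _ := ⟨0, by simp⟩
  -- By disjointness at most one bump is nonzero at a point, so any choice is the only one.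
  active x := if h : ∃ k, bump e k (x : E) ≠ 0 then {h.choose} else ∅
  bound := 2
  bound_nonneg := zero_le_two
  scale_pos k := by positivity
  dist_le := dist_closedBall_le
  param_lip k u v := by
    have h0 : 0 < (1 / 2 : ℝ) ^ k := by positivity
    rw [Subtype.dist_eq, Subtype.dist_eq, dist_add_left, dist_smul₀,
      Real.norm_of_nonneg (by positivity)]
    nlinarith [mul_nonneg h0.le (dist_nonneg (x := (u : E)) (y := v))]
  coord_lip k x y := by
    have h0 : 0 < (1 / 2 : ℝ) ^ k / 16 := by positivity
    have h := dist_radialRetraction_le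
      (((1 / 2 : ℝ) ^ k / 16)⁻¹ • ((x : E) - ((1 / 2 : ℝ) ^ k / 2) • e))
      (((1 / 2 : ℝ) ^ k / 16)⁻¹ • ((y : E) - ((1 / 2 : ℝ) ^ k / 2) • e))
    rw [← smul_sub, sub_sub_sub_cancel_right, norm_smul, norm_inv,
      Real.norm_of_nonneg h0.le] at h
    refine (mul_le_mul_of_nonneg_left h h0.le).trans_eq ?_
    rw [Subtype.dist_eq, dist_eq_norm]
    field_simp
  weight_nonneg _ _ := unitClamp_nonneg _
  weight_le_one _ _ := unitClamp_le_one _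
  weight_lip k x y := by
    have h0 : 0 < (1 / 2 : ℝ) ^ k / 16 := by positivity
    calc (1 / 2 : ℝ) ^ k / 16 * |bump e k x - bump e k y|
      _ ≤ (1 / 2 : ℝ) ^ k / 16 * |‖(y : E) - ((1 / 2 : ℝ) ^ k / 2) • e‖ -
          ‖(x : E) - ((1 / 2 : ℝ) ^ k / 2) • e‖| / ((1 / 2 : ℝ) ^ k / 16) := by
        rw [mul_div_assoc, ← abs_of_pos h0, ← abs_div, abs_of_pos h0]
        refine mul_le_mul_of_nonneg_left ((abs_unitClamp_sub_le _ _).trans_eq ?_) h0.le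
        congr 1
        ring
      _ = |‖(y : E) - ((1 / 2 : ℝ) ^ k / 2) • e‖ - ‖(x : E) - ((1 / 2 : ℝ) ^ k / 2) • e‖| := by
        field_simp
      _ ≤ dist x y := by
        rw [dist_comm, Subtype.dist_eq, dist_eq_norm]
        exact (abs_norm_sub_norm_le _ _).trans_eq (by rw [sub_sub_sub_cancel_right])
      _ ≤ 2 * dist x y := by linarith [dist_nonneg (x := x) (y := y)]
  card_active x := by
    split_ifs <;> simp
  weight_eq_zero x k hk := by
    by_contra h
    have hex : ∃ k, bump e k (x : E) ≠ 0 := ⟨k, h⟩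
    rw [dif_pos hex, Finset.mem_singleton] at hk
    exact hk (bump_disjoint he h hex.choose_spec)

/-- Each small ball is a similar copy of the unit ball on which its own bump is `1` and all others
vanish. The unit vector `e` gives the direction along which the balls are placed. -/
theorem finSum_isComplementedIn_closedBall {e : E} (he : ‖e‖ = 1) {p : ℝ} (hp : 0 < p)
    {α : ℝ} (hα₀ : 0 < α) (hα₁ : α ≤ 1) :
    IsComplementedIn
      (FinSum ℕ (Molecule p (Metric.Snowflaking (Metric.closedBall (0 : E) 1) α hα₀ hα₁)))
      (Molecule p (Metric.Snowflaking (Metric.closedBall (0 : E) 1) α hα₀ hα₁)) := by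
  have hone : ∀ k u, (ballCharts he).weight k ((ballCharts he).param k u) = 1 := fun k u => by
    have h0 : 0 < (1 / 2 : ℝ) ^ k / 16 := by positivity
    refine unitClamp_of_one_le ?_
    have hu := mem_closedBall_zero_iff.1 u.2
    simp only [ballCharts, add_sub_cancel_left, norm_smul]
    rw [Real.norm_of_nonneg h0.le, mul_div_cancel_left₀ _ h0.ne']
    linarith
  refine ((ballCharts he).snowflaking hα₀ hα₁).finSum_isComplementedIn hp ?_ ?_ ?_
  · rintro k ⟨u⟩
    refine congrArg Metric.Snowflaking.toSnowflaking ?_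
    have h0 : (1 / 2 : ℝ) ^ k / 16 ≠ 0 := by positivity
    change radialRetraction (((1 / 2 : ℝ) ^ k / 16)⁻¹ • (((1 / 2 : ℝ) ^ k / 2) • e +
      ((1 / 2 : ℝ) ^ k / 16) • (u : E) - ((1 / 2 : ℝ) ^ k / 2) • e)) = u
    rw [add_sub_cancel_left, inv_smul_smul₀ h0, radialRetraction_coe]
  · rintro k ⟨u⟩
    exact hone k u
  · rintro k j ⟨u⟩ hjk
    by_contra h
    refine hjk (bump_disjoint he h ?_)
    have := hone k u
    change bump e k _ = 1 at this
    exact this.trans_ne one_ne_zero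

/-! ### Concentric balls exhausting the space -/

/-- A dyadic partition of unity on `[0, ∞)`. -/
noncomputable def dyadicWeight : ℕ → ℝ → ℝ
  | 0, t => unitClamp (2 - t)
  | k + 1, t => unitClamp (2 - t / 2 ^ (k + 1)) - unitClamp (2 - t / 2 ^ k)

theorem dyadicWeight_nonneg (k : ℕ) {t : ℝ} (ht : 0 ≤ t) : 0 ≤ dyadicWeight k t := by
  cases k with
  | zero => exact unitClamp_nonneg _
  | succ k =>
    refine sub_nonneg.2 (unitClamp_mono (sub_le_sub_left ?_ _))
    gcongr
    · norm_num
    · omega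

theorem dyadicWeight_le (k : ℕ) (t : ℝ) : dyadicWeight k t ≤ unitClamp (2 - t / 2 ^ k) := by
  cases k with
  | zero => simp [dyadicWeight]
  | succ k => exact sub_le_self _ (unitClamp_nonneg _)

/-- The sum telescopes. -/
theorem sum_dyadicWeight (n : ℕ) (t : ℝ) :
    ∑ k ∈ Finset.range (n + 1), dyadicWeight k t = unitClamp (2 - t / 2 ^ n) := by
  induction n with
  | zero => simp [dyadicWeight]
  | succ n ih => rw [Finset.sum_range_succ, ih, dyadicWeight]; ring

theorem unitClamp_dyadic_eq_zero {k : ℕ} {t : ℝ} (h : 2 ^ (k + 1) ≤ t) :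
    unitClamp (2 - t / 2 ^ k) = 0 := by
  refine unitClamp_of_nonpos ?_
  have : (2 : ℝ) ≤ t / 2 ^ k := by
    rw [le_div_iff₀ (by positivity), ← pow_succ']
    exact h
  linarith

theorem unitClamp_dyadic_eq_one {n k : ℕ} (hnk : n ≤ k) {t : ℝ} (h : t ≤ 2 ^ n) :
    unitClamp (2 - t / 2 ^ k) = 1 := by
  refine unitClamp_of_one_le ?_
  have : t / 2 ^ k ≤ 1 := by
    rw [div_le_one (by positivity)]
    exact h.trans (pow_le_pow_right₀ one_le_two hnk)
  linarith

theorem dyadicWeight_eq_zero_of_le {k : ℕ} {t : ℝ} (h : 2 ^ (k + 1) ≤ t) :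
    dyadicWeight k t = 0 := by
  have ht : 0 ≤ t := le_trans (by positivity) h
  exact le_antisymm ((dyadicWeight_le k t).trans (unitClamp_dyadic_eq_zero h).le)
    (dyadicWeight_nonneg k ht)

theorem dyadicWeight_eq_zero_of_lt {n k : ℕ} (hnk : n < k) {t : ℝ} (h : t ≤ 2 ^ n) :
    dyadicWeight k t = 0 := by
  obtain ⟨k, rfl⟩ := Nat.exists_eq_succ_of_ne_zero (by omega : k ≠ 0)
  rw [Nat.succ_eq_add_one, dyadicWeight, unitClamp_dyadic_eq_one (by omega) h,
    unitClamp_dyadic_eq_one (by omega) h, sub_self]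

/-- The clamp at level `j` is `2^{-j}`-Lipschitz. At scale `2^{k+1}` the levels `k` and `k - 1` cost
`2` and `4`, which gives `6`. -/
theorem dyadicWeight_lip (k : ℕ) (s t : ℝ) :
    2 ^ (k + 1) * |dyadicWeight k s - dyadicWeight k t| ≤ 6 * |s - t| := by
  have key : ∀ j : ℕ, 2 ^ j * |unitClamp (2 - s / 2 ^ j) - unitClamp (2 - t / 2 ^ j)| ≤
      |s - t| := fun j => by
    have h := abs_unitClamp_sub_le (2 - s / 2 ^ j) (2 - t / 2 ^ j)
    rw [sub_sub_sub_cancel_left, ← sub_div, abs_div, abs_of_pos (by positivity : (0 : ℝ) < 2 ^ j),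
      le_div_iff₀ (by positivity), abs_sub_comm t s] at h
    linarith
  cases k with
  | zero =>
    have := key 0
    simp only [pow_zero, div_one, one_mul] at this
    simp only [dyadicWeight, zero_add, pow_one]
    linarith [abs_nonneg (s - t)]
  | succ k =>
    have h1 := key k
    have h2 := key (k + 1)
    have h3 := abs_sub (unitClamp (2 - s / 2 ^ (k + 1)) - unitClamp (2 - t / 2 ^ (k + 1)))
      (unitClamp (2 - s / 2 ^ k) - unitClamp (2 - t / 2 ^ k))
    rw [sub_sub_sub_comm] at h3
    have h4 := mul_le_mul_of_nonneg_left h3 (by positivity : (0 : ℝ) ≤ 2 ^ (k + 1 + 1))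
    simp only [dyadicWeight]
    rw [pow_succ (2 : ℝ) k] at h2 h4 ⊢
    rw [pow_succ (2 : ℝ) (k + 1), pow_succ (2 : ℝ) k] at h4 ⊢
    linarith

theorem exists_norm_le_two_pow {G : Type*} [SeminormedAddCommGroup G] (x : G) : ∃ n : ℕ, ‖x‖ ≤ 2 ^ n :=
  (pow_unbounded_of_one_lt ‖x‖ one_lt_two).imp fun _ => le_of_lt

open Classical in
variable (E) in
/-- Concentric balls of dyadic radii. -/
noncomputable def dyadicCharts : ChartFamily E (Metric.closedBall (0 : E) 1) where
  param k u := (2 : ℝ) ^ (k + 1) • (u : E)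
  coord k x := radialRetraction (((2 : ℝ) ^ (k + 1))⁻¹ • x)
  weight k x := dyadicWeight k ‖x‖
  -- The `k`-th weight vanishes from radius `2^{k+1}` on, so the retraction in `coord` is inactive
  -- wherever the weight is nonzero.
  scale k := 2 ^ (k + 1)
  base _ := ⟨0, by simp⟩
  -- With `n` least such that `‖x‖ ≤ 2^n`, weights with `k > n` or `k + 1 < n` vanish. For `n = 0`
  -- the truncated subtraction only repeats the index `0`.
  active x := {Nat.find (exists_norm_le_two_pow x) - 1, Nat.find (exists_norm_le_two_pow x)}
  bound := 6
  bound_nonneg := by norm_num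
  scale_pos k := by positivity
  dist_le u v := (dist_closedBall_le u v).trans (by norm_num)
  param_lip k u v := by
    rw [Subtype.dist_eq, dist_smul₀, Real.norm_of_nonneg (by positivity)]
    have : 0 ≤ 2 ^ (k + 1) * dist (u : E) v := by positivity
    linarith
  coord_lip k x y := by
    have h0 : (0 : ℝ) < 2 ^ (k + 1) := by positivity
    have h := dist_radialRetraction_le (((2 : ℝ) ^ (k + 1))⁻¹ • x) (((2 : ℝ) ^ (k + 1))⁻¹ • y)
    rw [← smul_sub, norm_smul, norm_inv, Real.norm_of_nonneg h0.le] at h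
    refine (mul_le_mul_of_nonneg_left h h0.le).trans ?_
    rw [dist_eq_norm]
    have : (2 : ℝ) ^ (k + 1) * (2 * (((2 : ℝ) ^ (k + 1))⁻¹ * ‖x - y‖)) = 2 * ‖x - y‖ := by
      field_simp
    linarith [norm_nonneg (x - y)]
  weight_nonneg k x := dyadicWeight_nonneg k (norm_nonneg x)
  weight_le_one k x := (dyadicWeight_le k _).trans (unitClamp_le_one _)
  weight_lip k x y := by
    refine (dyadicWeight_lip k _ _).trans ?_
    rw [dist_eq_norm]
    exact mul_le_mul_of_nonneg_left (abs_norm_sub_norm_le _ _) (by norm_num)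
  card_active x := Finset.card_le_two
  weight_eq_zero x k hk := by
    simp only [Finset.mem_insert, Finset.mem_singleton, not_or] at hk
    rcases lt_or_ge (Nat.find (exists_norm_le_two_pow x)) k with h | h
    · exact dyadicWeight_eq_zero_of_lt h (Nat.find_spec (exists_norm_le_two_pow x))
    · refine dyadicWeight_eq_zero_of_le ?_
      have := Nat.find_min (exists_norm_le_two_pow x)
        (by omega : k + 1 < Nat.find (exists_norm_le_two_pow x))
      exact (not_le.1 this).le

theorem isComplementedIn_finSum_closedBall {p : ℝ} (hp : 0 < p)
    {α : ℝ} (hα₀ : 0 < α) (hα₁ : α ≤ 1) :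
    IsComplementedIn (Molecule p (Metric.Snowflaking E α hα₀ hα₁))
      (FinSum ℕ (Molecule p (Metric.Snowflaking (Metric.closedBall (0 : E) 1) α hα₀ hα₁))) := by
  refine ((dyadicCharts E).snowflaking hα₀ hα₁).isComplementedIn_finSum hp (.toSnowflaking 0)
    (fun k => ?_) ?_ ?_
  · exact congrArg Metric.Snowflaking.toSnowflaking (smul_zero ((2 : ℝ) ^ (k + 1)))
  · rintro k ⟨x⟩ hk
    refine congrArg Metric.Snowflaking.toSnowflaking ?_
    have h0 : (0 : ℝ) < 2 ^ (k + 1) := by positivity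
    have hx : ‖x‖ ≤ 2 ^ (k + 1) := by
      by_contra! h
      exact hk (dyadicWeight_eq_zero_of_le h.le)
    change (2 : ℝ) ^ (k + 1) • (radialRetraction (((2 : ℝ) ^ (k + 1))⁻¹ • x) : E) = x
    rw [radialRetraction_of_norm_le, smul_inv_smul₀ h0.ne']
    rw [norm_smul, norm_inv, Real.norm_of_nonneg h0.le, inv_mul_le_iff₀ h0, mul_one]
    exact hx
  · rintro ⟨x⟩
    obtain ⟨n, hn⟩ := exists_norm_le_two_pow x
    refine ⟨Finset.range (n + 1), fun k hk => ?_, ?_⟩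
    · exact dyadicWeight_eq_zero_of_lt (by simpa using hk) hn
    · exact (sum_dyadicWeight n ‖x‖).trans (unitClamp_dyadic_eq_one le_rfl hn)

end

/-! ### Stereographic charts of the sphere -/

section
open Metric Module
open scoped RealInnerProductSpace

/-- The poles of the two stereographic charts. -/
def chartPole {G : Type*} [NormedAddCommGroup G] (v : G) (k : ℕ) : G := if k = 0 then v else -v

theorem norm_chartPole {G : Type*} [NormedAddCommGroup G] {v : G} (hv : ‖v‖ = 1) (k : ℕ) : ‖chartPole v k‖ = 1 := by
  unfold chartPole
  split_ifs <;> simp [hv]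

variable {d : ℕ} {E : Type*} [NormedAddCommGroup E] [InnerProductSpace ℝ E]

/-- The squared chord is `16 ‖w - z‖² / ((‖w‖² + 4)(‖z‖² + 4))`, and the denominator is at least
`16`. -/
theorem dist_stereoInvFun_le {v : E} (hv : ‖v‖ = 1) (w z : (ℝ ∙ v)ᗮ) :
    dist (stereoInvFun hv w) (stereoInvFun hv z) ≤ dist w z := by
  have hvw : ⟪v, (w : E)⟫ = 0 := Submodule.mem_orthogonal_singleton_iff_inner_right.mp w.2
  have hvz : ⟪v, (z : E)⟫ = 0 := Submodule.mem_orthogonal_singleton_iff_inner_right.mp z.2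
  have hwv : ⟪(w : E), v⟫ = 0 := by rw [real_inner_comm]; exact hvw
  have hn : ∀ y : (ℝ ∙ v)ᗮ, ‖(stereoInvFun hv y : E)‖ = 1 := fun y =>
    mem_sphere_zero_iff_norm.1 (stereoInvFun hv y).2
  rw [Subtype.dist_eq, Subtype.dist_eq, dist_eq_norm, dist_eq_norm]
  refine (sq_le_sq₀ (norm_nonneg _) (norm_nonneg _)).1 ?_
  have h1 : ⟪(stereoInvFun hv w : E), (stereoInvFun hv z : E)⟫ =
      (16 * ⟪(w : E), (z : E)⟫ + (‖(w : E)‖ ^ 2 - 4) * (‖(z : E)‖ ^ 2 - 4)) /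
        ((‖(w : E)‖ ^ 2 + 4) * (‖(z : E)‖ ^ 2 + 4)) := by
    have hvv : ⟪v, v⟫ = 1 := by simp [hv]
    simp only [stereoInvFun_apply, inner_smul_left, inner_smul_right, inner_add_left,
      inner_add_right, hvz, hwv, hvv, Submodule.coe_norm]
    simp only [conj_trivial]
    field_simp
    ring
  rw [norm_sub_sq_real, hn, hn, h1, norm_sub_sq_real]
  have hc := real_inner_le_norm (w : E) (z : E)
  have hD : 0 < (‖(w : E)‖ ^ 2 + 4) * (‖(z : E)‖ ^ 2 + 4) := by positivity
  have h2 : 0 ≤ ‖(w : E)‖ ^ 2 - 2 * ⟪(w : E), (z : E)⟫ + ‖(z : E)‖ ^ 2 := by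
    nlinarith [sq_nonneg (‖(w : E)‖ - ‖(z : E)‖)]
  have h3 : (1 : ℝ) ^ 2 - 2 * ((16 * ⟪(w : E), (z : E)⟫ +
      (‖(w : E)‖ ^ 2 - 4) * (‖(z : E)‖ ^ 2 - 4)) /
        ((‖(w : E)‖ ^ 2 + 4) * (‖(z : E)‖ ^ 2 + 4))) + 1 ^ 2 =
      16 * (‖(w : E)‖ ^ 2 - 2 * ⟪(w : E), (z : E)⟫ + ‖(z : E)‖ ^ 2) /
        ((‖(w : E)‖ ^ 2 + 4) * (‖(z : E)‖ ^ 2 + 4)) := by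
    field_simp
    ring
  rw [h3, div_le_iff₀ hD, mul_comm]
  refine mul_le_mul_of_nonneg_left ?_ h2
  nlinarith [sq_nonneg ‖(w : E)‖, sq_nonneg ‖(z : E)‖,
    mul_nonneg (sq_nonneg ‖(w : E)‖) (sq_nonneg ‖(z : E)‖)]

variable [Fact (finrank ℝ E = d + 1)]

variable (d) in
/-- Orthonormal coordinates on the hyperplane orthogonal to a unit vector. -/
noncomputable def hyperplaneCoord {v : E} (hv : ‖v‖ = 1) :
    (ℝ ∙ v)ᗮ ≃ₗᵢ[ℝ] EuclideanSpace ℝ (Fin d) :=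
  (OrthonormalBasis.fromOrthogonalSpanSingleton d (norm_pos_iff.1 (hv ▸ one_pos))).repr

variable (d) in
/-- Stereographic projection from `v`, modified near the pole so as to be Lipschitz. -/
noncomputable def stereoCoord {v : E} (hv : ‖v‖ = 1) (x : E) : EuclideanSpace ℝ (Fin d) :=
  -- Capping the height at `1 / 2` bounds the factor by `4` and leaves the projection unchanged at
  -- heights up to `1 / 2`.
  hyperplaneCoord d hv ((2 / (1 - min ⟪v, x⟫ (1 / 2))) • (ℝ ∙ v)ᗮ.orthogonalProjectionOnto x)

variable (d) in
/-- The inverse of the stereographic projection from `v`. -/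
noncomputable def stereoParam {v : E} (hv : ‖v‖ = 1) (u : EuclideanSpace ℝ (Fin d)) :
    sphere (0 : E) 1 :=
  stereoInvFun hv ((hyperplaneCoord d hv).symm u)

variable {v : E} (hv : ‖v‖ = 1)

theorem dist_stereoParam_le (u w : EuclideanSpace ℝ (Fin d)) :
    dist (stereoParam d hv u) (stereoParam d hv w) ≤ dist u w :=
  (dist_stereoInvFun_le hv _ _).trans_eq ((hyperplaneCoord d hv).symm.dist_map u w)

theorem stereoParam_stereoCoord {x : sphere (0 : E) 1} (hx : ⟪v, (x : E)⟫ ≤ 1 / 2) :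
    stereoParam d hv (stereoCoord d hv x) = x := by
  have hxv : (x : E) ≠ v := fun h => by
    rw [h, real_inner_self_eq_norm_sq, hv] at hx
    norm_num at hx
  rw [stereoParam, stereoCoord, min_eq_left hx, LinearIsometryEquiv.symm_apply_apply]
  exact stereo_left_inv hv hxv

theorem stereoCoord_stereoParam {u : EuclideanSpace ℝ (Fin d)} (hu : ‖u‖ ≤ 2) :
    stereoCoord d hv (stereoParam d hv u) = u := by
  set w := (hyperplaneCoord d hv).symm u with hw
  have hwn : ‖w‖ ≤ 2 := by rwa [hw, LinearIsometryEquiv.norm_map]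
  have hvw : ⟪v, (w : E)⟫ = 0 := Submodule.mem_orthogonal_singleton_iff_inner_right.mp w.2
  -- The height is `(‖w‖² - 4) / (‖w‖² + 4)`, which is nonpositive for `‖w‖ ≤ 2`; the cap is
  -- therefore inactive.
  have hin : ⟪v, (stereoInvFun hv w : E)⟫ ≤ 1 / 2 := by
    have hvv : ⟪v, v⟫ = 1 := by simp [hv]
    rw [stereoInvFun_apply, inner_smul_right, inner_add_right, inner_smul_right,
      inner_smul_right, hvw, hvv, inv_mul_le_iff₀ (by positivity)]
    nlinarith [norm_nonneg w]
  have h := stereo_right_inv hv w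
  rw [stereoCoord, stereoParam, ← hw, min_eq_left hin]
  rw [stereoToFun_apply, innerSL_apply_apply] at h
  rw [h, hw, LinearIsometryEquiv.apply_symm_apply]

theorem two_div_one_sub_min_le (t : ℝ) : 2 / (1 - min t (1 / 2)) ≤ 4 := by
  have h := min_le_right t (1 / 2)
  rw [div_le_iff₀ (by linarith)]
  linarith

theorem two_div_one_sub_min_nonneg (t : ℝ) : 0 ≤ 2 / (1 - min t (1 / 2)) := by
  have h := min_le_right t (1 / 2)
  exact div_nonneg zero_le_two (by linarith)

theorem abs_two_div_one_sub_min_sub_le (s t : ℝ) :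
    |2 / (1 - min s (1 / 2)) - 2 / (1 - min t (1 / 2))| ≤ 8 * |s - t| := by
  have hs := min_le_right s (1 / 2)
  have ht := min_le_right t (1 / 2)
  have hst : |min s (1 / 2) - min t (1 / 2)| ≤ |s - t| := by
    simpa using abs_min_sub_min_le_max s (1 / 2) t (1 / 2)
  set a := min s (1 / 2)
  set b := min t (1 / 2)
  have ha : 0 < 1 - a := by linarith
  have hb : 0 < 1 - b := by linarith
  have h : 2 / (1 - a) - 2 / (1 - b) = 2 / ((1 - a) * (1 - b)) * (a - b) := by
    field_simp
    ring
  rw [h, abs_mul, abs_of_pos (by positivity)]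
  refine mul_le_mul ?_ hst (abs_nonneg _) (by norm_num)
  rw [div_le_iff₀ (by positivity)]
  nlinarith [mul_nonneg (sub_nonneg.2 hs) (sub_nonneg.2 ht)]

theorem norm_stereoCoord_le (x : sphere (0 : E) 1) : ‖stereoCoord d hv x‖ ≤ 4 := by
  have hx : ‖(x : E)‖ = 1 := mem_sphere_zero_iff_norm.1 x.2
  rw [stereoCoord, LinearIsometryEquiv.norm_map, norm_smul,
    Real.norm_of_nonneg (two_div_one_sub_min_nonneg _)]
  have h1 := two_div_one_sub_min_le ⟪v, (x : E)⟫
  have h2 := (ℝ ∙ v)ᗮ.norm_orthogonalProjectionOnto_apply_le (x : E)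
  calc _ ≤ 4 * ‖(x : E)‖ := mul_le_mul h1 h2 (norm_nonneg _) (by norm_num)
    _ = 4 := by rw [hx, mul_one]

/-- The constant is `4 + 8`: the size of the conformal factor plus its Lipschitz constant, the
projection being a contraction. -/
theorem norm_stereoCoord_sub_le (x y : sphere (0 : E) 1) :
    ‖stereoCoord d hv x - stereoCoord d hv y‖ ≤ 12 * ‖(x : E) - y‖ := by
  have hy : ‖(y : E)‖ = 1 := mem_sphere_zero_iff_norm.1 y.2
  rw [stereoCoord, stereoCoord, ← map_sub, LinearIsometryEquiv.norm_map]
  set P := (ℝ ∙ v)ᗮ.orthogonalProjectionOnto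
  have h1 := two_div_one_sub_min_le ⟪v, (x : E)⟫
  have h0 := two_div_one_sub_min_nonneg ⟪v, (x : E)⟫
  have h2 := abs_two_div_one_sub_min_sub_le ⟪v, (x : E)⟫ ⟪v, (y : E)⟫
  set a := 2 / (1 - min ⟪v, (x : E)⟫ (1 / 2))
  set b := 2 / (1 - min ⟪v, (y : E)⟫ (1 / 2))
  have h3 : a • P x - b • P y = a • P (x - y) + (a - b) • P y := by
    rw [map_sub]
    module
  have h4 : |⟪v, (x : E)⟫ - ⟪v, (y : E)⟫| ≤ ‖(x : E) - y‖ := by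
    rw [← inner_sub_right]
    simpa [hv] using abs_real_inner_le_norm v ((x : E) - y)
  have h5 : ‖P (x - y)‖ ≤ ‖(x : E) - y‖ := Submodule.norm_orthogonalProjectionOnto_apply_le _ _
  have h6 : ‖P y‖ ≤ 1 := (Submodule.norm_orthogonalProjectionOnto_apply_le _ _).trans_eq hy
  rw [h3]
  refine (norm_add_le _ _).trans ?_
  rw [norm_smul, norm_smul, Real.norm_of_nonneg h0, Real.norm_eq_abs]
  have h7 : a * ‖P (x - y)‖ ≤ 4 * ‖(x : E) - y‖ := mul_le_mul h1 h5 (norm_nonneg _) (by norm_num)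
  have h8 : |a - b| * ‖P y‖ ≤ 8 * ‖(x : E) - y‖ * 1 :=
    mul_le_mul (h2.trans (by linarith)) h6 (norm_nonneg _) (by positivity)
  linarith

theorem dist_radialRetraction_stereoCoord_le {c : ℝ} (hc : 0 ≤ c) (hc' : c ≤ 1 / 2)
    (x y : sphere (0 : E) 1) :
    dist (radialRetraction (c • stereoCoord d hv x)) (radialRetraction (c • stereoCoord d hv y)) ≤
      12 * dist x y := by
  refine (dist_radialRetraction_le _ _).trans ?_
  rw [← smul_sub, norm_smul, Real.norm_of_nonneg hc, Subtype.dist_eq, dist_eq_norm]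
  have h := norm_stereoCoord_sub_le (d := d) hv x y
  have := mul_le_mul hc' h (norm_nonneg _) (by norm_num)
  linarith

theorem isComplementedIn_sphere (hv : ‖v‖ = 1) {p : ℝ} (hp : 0 < p) {α : ℝ} (hα₀ : 0 < α)
    (hα₁ : α ≤ 1) :
    IsComplementedIn
      (Molecule p (Snowflaking (closedBall (0 : EuclideanSpace ℝ (Fin d)) 1) α hα₀ hα₁))
      (Molecule p (Snowflaking (sphere (0 : E) 1) α hα₀ hα₁)) := by
  have : Nonempty (closedBall (0 : EuclideanSpace ℝ (Fin d)) 1) := ⟨⟨0, by simp⟩⟩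
  refine Molecule.isComplementedIn_snowflaking_of_retract hp hα₀ hα₁
    -- The ball of radius `2` parametrizes the hemisphere opposite to `v`, where `stereoCoord` is an
    -- exact inverse.
    (i := fun u => stereoParam d hv ((2 : ℝ) • (u : EuclideanSpace ℝ (Fin d))))
    (r := fun x => radialRetraction ((1 / 2 : ℝ) • stereoCoord d hv x)) (C := 12) (by norm_num)
    (fun u w => ?_) (dist_radialRetraction_stereoCoord_le hv (by norm_num) le_rfl) fun u => ?_
  · refine (dist_stereoParam_le hv _ _).trans ?_
    rw [dist_smul₀, Real.norm_of_nonneg zero_le_two, Subtype.dist_eq]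
    linarith [dist_nonneg (x := (u : EuclideanSpace ℝ (Fin d))) (y := w)]
  · have hu := mem_closedBall_zero_iff.1 u.2
    rw [stereoCoord_stereoParam, smul_smul]
    · norm_num [radialRetraction_coe]
    · rw [norm_smul, Real.norm_of_nonneg zero_le_two]
      linarith

/-- The cut-off functions of the two stereographic charts. -/
noncomputable def sphereWeight (v : E) (k : ℕ) (x : E) : ℝ :=
  -- Only charts `0` and `1` matter; the others have weight zero and merely fill the index set `ℕ`.
  -- A nonzero weight forces height below `1 / 2`, where the capped projection is the true one.
  if k ≤ 1 then unitClamp (1 / 2 - ⟪chartPole v k, x⟫) else 0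

variable (d) in
/-- The two stereographic charts of the sphere with poles `v` and `-v`. -/
noncomputable def sphereCharts (o : sphere (0 : E) 1) :
    ChartFamily (sphere (0 : E) 1) (closedBall (0 : EuclideanSpace ℝ (Fin d)) 1) where
  -- The factor `4` is the bound of `norm_stereoCoord_le`: after division by it, coordinates lie in
  -- the unit ball and the retraction does not move them.
  param k u := stereoParam d (norm_chartPole hv k) ((4 : ℝ) • (u : EuclideanSpace ℝ (Fin d)))
  coord k x := radialRetraction ((1 / 4 : ℝ) • stereoCoord d (norm_chartPole hv k) x)
  weight k x := sphereWeight v k x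
  scale _ := 1
  base k := radialRetraction ((1 / 4 : ℝ) • stereoCoord d (norm_chartPole hv k) o)
  active _ := {0, 1}
  bound := 12
  bound_nonneg := by norm_num
  scale_pos _ := one_pos
  dist_le u w := (dist_closedBall_le u w).trans (by norm_num)
  param_lip k u w := by
    refine (dist_stereoParam_le _ _ _).trans ?_
    rw [dist_smul₀, Real.norm_of_nonneg (by norm_num), Subtype.dist_eq]
    linarith [dist_nonneg (x := (u : EuclideanSpace ℝ (Fin d))) (y := w)]
  coord_lip k x y := by
    rw [one_mul]
    exact dist_radialRetraction_stereoCoord_le _ (by norm_num) (by norm_num) x y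
  weight_nonneg k x := by
    unfold sphereWeight
    split_ifs
    exacts [unitClamp_nonneg _, le_rfl]
  weight_le_one k x := by
    unfold sphereWeight
    split_ifs
    exacts [unitClamp_le_one _, zero_le_one]
  weight_lip k x y := by
    have h0 := dist_nonneg (x := x) (y := y)
    rw [one_mul]
    unfold sphereWeight
    split_ifs
    · refine (abs_unitClamp_sub_le _ _).trans ?_
      rw [sub_sub_sub_cancel_left, ← inner_sub_right]
      refine (abs_real_inner_le_norm _ _).trans ?_
      rw [norm_chartPole hv, one_mul, ← dist_eq_norm, dist_comm, ← Subtype.dist_eq]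
      linarith
    · rw [sub_self, abs_zero]
      linarith
  card_active _ := Finset.card_le_two
  weight_eq_zero x k hk := by
    simp only [Finset.mem_insert, Finset.mem_singleton, not_or] at hk
    exact if_neg (by omega)

theorem param_coord_sphereCharts (o : sphere (0 : E) 1) (k : ℕ) {x : sphere (0 : E) 1}
    (hx : ⟪chartPole v k, (x : E)⟫ ≤ 1 / 2) :
    (sphereCharts d hv o).param k ((sphereCharts d hv o).coord k x) = x := by
  change stereoParam d (norm_chartPole hv k) ((4 : ℝ) •
    (radialRetraction ((1 / 4 : ℝ) • stereoCoord d (norm_chartPole hv k) x) :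
      EuclideanSpace ℝ (Fin d))) = x
  rw [radialRetraction_of_norm_le, smul_smul]
  · norm_num
    exact stereoParam_stereoCoord _ hx
  · rw [norm_smul, Real.norm_of_nonneg (by norm_num)]
    linarith [norm_stereoCoord_le (d := d) (norm_chartPole hv k) x]

theorem sphere_isComplementedIn_finSum (hv : ‖v‖ = 1) {o : E} (ho : ‖o‖ = 1) (hvo : ⟪v, o⟫ = 0)
    {p : ℝ} (hp : 0 < p) {α : ℝ} (hα₀ : 0 < α) (hα₁ : α ≤ 1) :
    IsComplementedIn (Molecule p (Snowflaking (sphere (0 : E) 1) α hα₀ hα₁))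
      (FinSum ℕ (Molecule p
        (Snowflaking (closedBall (0 : EuclideanSpace ℝ (Fin d)) 1) α hα₀ hα₁))) := by
  have ho' : o ∈ sphere (0 : E) 1 := mem_sphere_zero_iff_norm.2 ho
  refine ((sphereCharts d hv ⟨o, ho'⟩).snowflaking hα₀ hα₁).isComplementedIn_finSum hp
    (.toSnowflaking ⟨o, ho'⟩) (fun k => ?_) ?_ ?_
  -- Being orthogonal to `v`, the point `o` has height `0` for both poles, so every chart recovers
  -- it and it can serve as common base point.
  · refine congrArg Snowflaking.toSnowflaking
      (param_coord_sphereCharts hv ⟨o, ho'⟩ k (x := ⟨o, ho'⟩) ?_)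
    unfold chartPole
    split_ifs <;> simp [hvo]
  · rintro k ⟨x⟩ hk
    refine congrArg Snowflaking.toSnowflaking (param_coord_sphereCharts hv ⟨o, ho'⟩ k ?_)
    change ⟪chartPole v k, (x : E)⟫ ≤ 1 / 2
    by_contra! h
    have hk : sphereWeight v k x ≠ 0 := hk
    unfold sphereWeight at hk
    split_ifs at hk
    · exact hk (unitClamp_of_nonpos (by linarith))
    · exact hk rfl
  · rintro ⟨x⟩
    refine ⟨{0, 1}, (sphereCharts d hv ⟨o, ho'⟩).weight_eq_zero x, ?_⟩
    rw [Finset.sum_pair zero_ne_one]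
    change sphereWeight v 0 x + sphereWeight v 1 x = 1
    have h : (1 / 2 - -⟪v, (x : E)⟫) = 1 - (1 / 2 - ⟪v, (x : E)⟫) := by ring
    simp only [sphereWeight, chartPole, zero_le_one, le_refl, if_true, one_ne_zero, if_false,
      inner_neg_left, h, unitClamp_one_sub]
    ring

end

/-! ### The isomorphism theorem -/

theorem theorem4 (d : ℕ) (hd : 1 ≤ d) (p : ℝ) (hp₀ : 0 < p) (hp₁ : p ≤ 1)
    (α : ℝ) (hα₀ : 0 < α) (hα₁ : α ≤ 1) :
    Nonempty
      (LipFree p (Metric.Snowflaking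
          (Metric.sphere (0 : EuclideanSpace ℝ (Fin (d + 1))) 1) α hα₀ hα₁) ≃L[ℝ]
        LipFree p (Metric.Snowflaking (EuclideanSpace ℝ (Fin d)) α hα₀ hα₁)) ∧
    Nonempty
      (LipFree p (Metric.Snowflaking
          (Metric.sphere (0 : EuclideanSpace ℝ (Fin (d + 1))) 1) α hα₀ hα₁) ≃L[ℝ]
        LipFree p (Metric.Snowflaking
          (Metric.closedBall (0 : EuclideanSpace ℝ (Fin d)) 1) α hα₀ hα₁)) := by
  have : Fact (Module.finrank ℝ (EuclideanSpace ℝ (Fin (d + 1))) = d + 1) := ⟨by simp⟩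
  have hv : ‖EuclideanSpace.single (0 : Fin (d + 1)) (1 : ℝ)‖ = 1 := by simp
  have ho : ‖EuclideanSpace.single (Fin.last d) (1 : ℝ)‖ = 1 := by simp
  have hvo : inner ℝ (EuclideanSpace.single (0 : Fin (d + 1)) (1 : ℝ))
      (EuclideanSpace.single (Fin.last d) (1 : ℝ)) = 0 := by
    -- Here `d ≥ 1` provides a second coordinate axis, hence a point of the sphere on the equator.
    have h : (0 : Fin (d + 1)) ≠ Fin.last d := Fin.ne_of_val_ne (by simp; omega)
    simp [EuclideanSpace.inner_single_left, h]
  have he : ‖EuclideanSpace.single (⟨0, hd⟩ : Fin d) (1 : ℝ)‖ = 1 := by simp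
  have hball := finSum_isComplementedIn_closedBall he hp₀ hα₀ hα₁
  have : Nonempty (Metric.closedBall (0 : EuclideanSpace ℝ (Fin d)) 1) := ⟨⟨0, by simp⟩⟩
  have hspace := Molecule.isComplementedIn_snowflaking_of_retract hp₀ hα₀ hα₁
    (i := fun u : Metric.closedBall (0 : EuclideanSpace ℝ (Fin d)) 1 =>
      (u : EuclideanSpace ℝ (Fin d))) (r := radialRetraction) (C := 2) zero_le_two
    (fun u w => by
      rw [← Subtype.dist_eq]
      linarith [dist_nonneg (x := u) (y := w)])
    (fun x y => by simpa [dist_eq_norm] using dist_radialRetraction_le x y) radialRetraction_coe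
  -- All three spaces are compared with the same sum of copies of the molecules over the ball; the
  -- sphere and the whole space inherit its complemented copy through the ball.
  have hB := BoundedIso.of_isComplementedIn hball (FinSum.isComplementedIn 0)
  have hR := BoundedIso.of_isComplementedIn (hball.trans hspace)
    (isComplementedIn_finSum_closedBall hp₀ hα₀ hα₁)
  have hS := BoundedIso.of_isComplementedIn
    (hball.trans (isComplementedIn_sphere hv hp₀ hα₀ hα₁))
    (sphere_isComplementedIn_finSum hv ho hvo hp₀ hα₀ hα₁)
  exact ⟨(hS.trans hR.symm).completion, (hS.trans hB.symm).completion⟩
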